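/- Let $d\ge 1$ and $\alpha\in(1,2)$, and let $X_\alpha$ be a rotationally invariant $\alpha$-stable random vector in $\mathbb R^d$ with law $\mu_\alpha$ and characteristic function $$\mathbb E\, e^{i\langle \xi;X_\alpha\rangle}=\exp\left(-\frac{\|\xi\|^\alpha}{2}\right),\qquad \xi\in\mathbb R^d .$$ Let $\nu_\alpha$ be its Lévy measure, $$\nu_\alpha(du)=\frac{c_{\alpha,d}}{\|u\|^{d+\alpha}}\,du,\qquad c_{\alpha,d}=\frac{-\alpha(\alpha-1)\,\Gamma\left(\frac{\alpha+d}{2}\right)}{4\cos\left(\frac{\alpha\pi}{2}\right)\Gamma\left(\frac{\alpha+1}{2}\right)\pi^{(d-1)/2}\,\Gamma(2-\alpha)} .$$ For a probability measure $\mu$ on $\mathbb R^d$ and a random vector $X$ with law $\mu$, define $$U_\alpha(\mu)=\sup_{f\in\mathcal H_\alpha}\frac{\operatorname{Var}(f(X))}{\mathbb E\int_{\mathbb R^d}|f(X+u)-f(X)|^2\,\nu_\alpha(du)}\in[0,+\infty],$$ where $\mathcal H_\alpha$ is the set of Borel measurable functions $f:\mathbb R^d\to\mathbb R$ such that $\operatorname{Var}(f(X))<+\infty$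 and $0<\mathbb E\int_{\mathbb R^d}|f(X+u)-f(X)|^2\,\nu_\alpha(du)<+\infty$. Then $$U_\alpha(\mu_\alpha)=1 .$$ -/

import Mathlib

open MeasureTheory ProbabilityTheory
open scoped ENNReal

noncomputable section

/-- The normalizing constant of the rotationally invariant `α`-stable Lévy measure on `ℝ^d`,
`c_{α,d} = -α (α - 1) Γ((α + d) / 2) /
  (4 cos(α π / 2) Γ((α + 1) / 2) π^((d - 1) / 2) Γ(2 - α))`,
which is positive for `1 < α < 2`. -/
def stableConst (d : ℕ) (α : ℝ) : ℝ :=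
  (-α * (α - 1) * Real.Gamma ((α + d) / 2)) /
    (4 * Real.cos (α * Real.pi / 2) * Real.Gamma ((α + 1) / 2) *
      Real.pi ^ (((d : ℝ) - 1) / 2) * Real.Gamma (2 - α))

/-- The Lévy measure `ν_α(du) = c_{α,d} du / ‖u‖^(d + α)` on `ℝ^d`; in polar coordinates `u = r x`
it is `c_{α,d} r^(-α-1) dr σ(dx)` with `σ` the surface measure of the unit sphere. -/
def stableLevyMeasure (d : ℕ) (α : ℝ) : Measure (EuclideanSpace ℝ (Fin d)) :=
  volume.withDensity fun u => ENNReal.ofReal (stableConst d α / ‖u‖ ^ ((d : ℝ) + α))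

/-- The non-local energy `E ∫ |f(X + u) - f(X)|² ν_α(du)`, where `X` has law `μ`. -/
def nonlocalEnergy (d : ℕ) (α : ℝ) (μ : Measure (EuclideanSpace ℝ (Fin d)))
    (f : EuclideanSpace ℝ (Fin d) → ℝ) : ℝ≥0∞ :=
  ∫⁻ x, ∫⁻ u, ENNReal.ofReal (|f (x + u) - f x| ^ 2) ∂(stableLevyMeasure d α) ∂μ

/-- The class of Borel functions `f` such that `Var (f(X)) < ∞` and
`0 < E ∫ |f(X + u) - f(X)|² ν_α(du) < ∞`, where `X` has law `μ`. -/
def admissibleClass (d : ℕ) (α : ℝ) (μ : Measure (EuclideanSpace ℝ (Fin d))) :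
    Set (EuclideanSpace ℝ (Fin d) → ℝ) :=
  {f | Measurable f ∧ MemLp f 2 μ ∧ 0 < nonlocalEnergy d α μ f ∧ nonlocalEnergy d α μ f < ∞}

/-- The Poincaré ratio functional
`U_α(μ) = sup_f Var (f(X)) / E ∫ |f(X + u) - f(X)|² ν_α(du)`, where `X` has law `μ` and `f` runs
over the admissible class of `μ`; the supremum is taken in `[0, ∞]`. -/
def poincareU (d : ℕ) (α : ℝ) (μ : Measure (EuclideanSpace ℝ (Fin d))) : ℝ≥0∞ :=
  ⨆ f ∈ admissibleClass d α μ, evariance f μ / nonlocalEnergy d α μ f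

end

/-! ### Variance of a function of a sum of independent vectors. -/

section Convolution

variable {E : Type*} [NormedAddCommGroup E] [MeasurableSpace E] [BorelSpace E]
  [SecondCountableTopology E]

/-! The upper bound is a Poincaré inequality with constant 1, inherited from compound Poisson laws.
Gamma and Gaussian integrals show that `∫ (1 - cos ⟨u, ξ⟩) ν_α(du) = ‖ξ‖^α / 2`. Hence, for each `ε
> 0`, `μ` is the convolution of the compound Poisson law of the jumps larger than `ε` with a law `ρ`
of the small jumps (`compoundPoisson_conv_smallJumps`).

For a finite Lévy measure `l`, the compound Poisson law is an `n`-fold convolution of those of `l /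
n`. Variance is subadditive over independent summands, and each summand makes at most one jump up to
an error of order `1 / n ^ 2`. Summing and letting `n → ∞` gives `variance_compoundPoisson_le`. In
the law of total variance for `μ`, this bounds the mean conditional variance given the small jumps.
The other term, the variance of the conditional expectation, vanishes with `ε` because `ρ`
concentrates at the origin (`variance_le_of_conv_compoundPoisson`). Truncation removes the
boundedness of `f`.

For the lower bound, test the characters `x ↦ exp(i⟨x, ξ⟩)` through their real and imaginary parts.
With `t = ‖ξ‖^α`, the two energies add up to `t` and the two variances to `1 - exp(-t)`, so `U_α(μ)
≥ (1 - exp(-t)) / t`, which tends to 1 as `t → 0`. -/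

lemma integrable_of_abs_le {Ω : Type*} [MeasurableSpace Ω] {μ : Measure Ω} [IsFiniteMeasure μ]
    {f : Ω → ℝ} (hf : Measurable f) {M : ℝ} (hM : ∀ x, |f x| ≤ M) : Integrable f μ :=
  .of_bound hf.aestronglyMeasurable M (.of_forall hM)

lemma memLp_two_of_abs_le {Ω : Type*} [MeasurableSpace Ω] {μ : Measure Ω} [IsFiniteMeasure μ]
    {f : Ω → ℝ} (hf : Measurable f) {M : ℝ} (hM : ∀ x, |f x| ≤ M) : MemLp f 2 μ :=
  .of_bound hf.aestronglyMeasurable M (.of_forall hM)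

lemma abs_integral_le_of_abs_le {Ω : Type*} [MeasurableSpace Ω] {μ : Measure Ω}
    [IsProbabilityMeasure μ] {f : Ω → ℝ} {M : ℝ} (hM : ∀ x, |f x| ≤ M) : |∫ x, f x ∂μ| ≤ M := by
  simpa using norm_integral_le_of_norm_le_const (μ := μ) (f := f) (.of_forall hM)

lemma sq_integral_le {Ω : Type*} [MeasurableSpace Ω] {μ : Measure Ω}
    [IsProbabilityMeasure μ] {f : Ω → ℝ} (hf : MemLp f 2 μ) :
    (∫ x, f x ∂μ) ^ 2 ≤ ∫ x, f x ^ 2 ∂μ := by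
  have h := variance_nonneg f μ
  rw [variance_eq_sub hf] at h
  simpa using h

lemma abs_sq_le_of_abs_le {a M : ℝ} (h : |a| ≤ M) : |a ^ 2| ≤ M ^ 2 := by
  rw [abs_pow]; exact pow_le_pow_left₀ (abs_nonneg _) h 2

lemma measurable_integral_add_right (a : Measure E) [SFinite a] {f : E → ℝ} (hf : Measurable f) :
    Measurable fun y ↦ ∫ x, f (x + y) ∂a := by
  have : StronglyMeasurable fun y ↦ ∫ x, f (x + y) ∂a :=
    StronglyMeasurable.integral_prod_right (f := fun y x ↦ f (x + y))
      (Measurable.stronglyMeasurable (by unfold Function.uncurry; fun_prop))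
  exact this.measurable

lemma integral_conv_eq (a b : Measure E) [IsFiniteMeasure a] [IsFiniteMeasure b] {f : E → ℝ}
    (hf : Measurable f) {M : ℝ} (hM : ∀ x, |f x| ≤ M) :
    ∫ z, f z ∂(a ∗ b) = ∫ x, ∫ y, f (x + y) ∂b ∂a := by
  rw [Measure.conv, integral_map (by fun_prop) hf.aestronglyMeasurable,
    integral_prod (fun z : E × E ↦ f (z.1 + z.2))
      (integrable_of_abs_le (by fun_prop) fun _ ↦ hM _)]

lemma integral_conv_eq' (a b : Measure E) [IsFiniteMeasure a] [IsFiniteMeasure b] {f : E → ℝ}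
    (hf : Measurable f) {M : ℝ} (hM : ∀ x, |f x| ≤ M) :
    ∫ z, f z ∂(a ∗ b) = ∫ y, ∫ x, f (x + y) ∂a ∂b := by
  rw [Measure.conv_comm, integral_conv_eq b a hf hM]
  simp_rw [add_comm]

/-- The law of total variance for a sum of independent vectors. -/
lemma variance_conv (a b : Measure E) [IsProbabilityMeasure a] [IsProbabilityMeasure b]
    {f : E → ℝ} (hf : Measurable f) {M : ℝ} (hM : ∀ x, |f x| ≤ M) :
    Var[f; a ∗ b] = ∫ y, Var[fun x ↦ f (x + y); a] ∂b + Var[fun y ↦ ∫ x, f (x + y) ∂a; b] := by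
  have hFm := measurable_integral_add_right a hf
  have hFb : ∀ y, |∫ x, f (x + y) ∂a| ≤ M := fun y ↦ abs_integral_le_of_abs_le fun x ↦ hM _
  have h2 := measurable_integral_add_right a (hf.pow_const 2)
  have h2b : ∀ y, |∫ x, f (x + y) ^ 2 ∂a| ≤ M ^ 2 := fun y ↦
    abs_integral_le_of_abs_le fun x ↦ abs_sq_le_of_abs_le (hM _)
  have hv : ∀ y, Var[fun x ↦ f (x + y); a] =
      (∫ x, f (x + y) ^ 2 ∂a) - (∫ x, f (x + y) ∂a) ^ 2 := fun y ↦ by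
    rw [variance_eq_sub (memLp_two_of_abs_le (by fun_prop) fun x ↦ hM _)]
    simp
  rw [variance_eq_sub (memLp_two_of_abs_le hf hM), variance_eq_sub (memLp_two_of_abs_le hFm hFb)]
  simp_rw [hv]
  rw [integral_sub (integrable_of_abs_le h2 h2b)
    (integrable_of_abs_le (hFm.pow_const 2) fun y ↦ abs_sq_le_of_abs_le (hFb y)),
    integral_conv_eq' a b hf hM]
  have := integral_conv_eq' a b (hf.pow_const 2) fun x ↦ abs_sq_le_of_abs_le (hM x)
  simp only [Pi.pow_apply]
  rw [this]
  ring

lemma measurable_variance_add_left (b : Measure E) [IsProbabilityMeasure b]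
    {f : E → ℝ} (hf : Measurable f) {M : ℝ} (hM : ∀ x, |f x| ≤ M) :
    Measurable fun x ↦ Var[fun y ↦ f (x + y); b] := by
  have h1 := measurable_integral_add_right b hf
  have h2 := measurable_integral_add_right b (hf.pow_const 2)
  convert! h2.sub (h1.pow_const 2) using 1
  ext x
  rw [variance_eq_sub (memLp_two_of_abs_le (by fun_prop) fun y ↦ hM _)]
  simp [add_comm]

lemma variance_le_sq_of_abs_le {Ω : Type*} [MeasurableSpace Ω] {μ : Measure Ω}
    [IsProbabilityMeasure μ] {f : Ω → ℝ} (hf : Measurable f) {M : ℝ} (hM : ∀ x, |f x| ≤ M) :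
    |Var[f; μ]| ≤ M ^ 2 := by
  rw [abs_of_nonneg (variance_nonneg _ _)]
  refine (variance_le_expectation_sq hf.aestronglyMeasurable).trans ?_
  refine (le_abs_self _).trans (abs_integral_le_of_abs_le fun x ↦ ?_)
  exact abs_sq_le_of_abs_le (hM x)

/-- Averaging over an independent summand decreases the variance. -/
lemma variance_integral_le (a b : Measure E) [IsProbabilityMeasure a] [IsProbabilityMeasure b]
    {f : E → ℝ} (hf : Measurable f) {M : ℝ} (hM : ∀ x, |f x| ≤ M) :
    Var[fun y ↦ ∫ x, f (x + y) ∂a; b] ≤ ∫ x, Var[fun y ↦ f (x + y); b] ∂a := by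
  have hFm := measurable_integral_add_right a hf
  have hFb : ∀ y, |∫ x, f (x + y) ∂a| ≤ M := fun y ↦ abs_integral_le_of_abs_le fun x ↦ hM _
  have hGm : Measurable fun x ↦ ∫ y, f (x + y) ∂b := by
    simpa only [add_comm] using measurable_integral_add_right b hf
  have hGb : ∀ x, |∫ y, f (x + y) ∂b| ≤ M := fun y ↦ abs_integral_le_of_abs_le fun x ↦ hM _
  have hHm : Measurable fun z : E × E ↦ f (z.1 + z.2) - ∫ y, f (z.1 + y) ∂b :=
    (hf.comp (measurable_fst.add measurable_snd)).sub (hGm.comp measurable_fst)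
  have hHb : ∀ x y, |f (x + y) - ∫ y, f (x + y) ∂b| ≤ M + M := fun x y ↦
    (abs_sub _ _).trans (add_le_add (hM _) (hGb _))
  have hswap : ∫ y, ∫ x, f (x + y) ∂a ∂b = ∫ x, ∫ y, f (x + y) ∂b ∂a := by
    rw [← integral_conv_eq a b hf hM, integral_conv_eq' a b hf hM]
  rw [variance_eq_integral hFm.aemeasurable]
  have hvar : ∀ x, Var[fun y ↦ f (x + y); b] = ∫ y, (f (x + y) - ∫ y, f (x + y) ∂b) ^ 2 ∂b :=
    fun x ↦ variance_eq_integral (by fun_prop)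
  simp_rw [hvar]
  have hint : Integrable (fun z : E × E ↦ (f (z.1 + z.2) - ∫ y, f (z.1 + y) ∂b) ^ 2) (a.prod b) :=
    integrable_of_abs_le (hHm.pow_const 2) fun z ↦ abs_sq_le_of_abs_le (hHb z.1 z.2)
  rw [integral_integral_swap (f := fun x y ↦ (f (x + y) - ∫ y, f (x + y) ∂b) ^ 2) hint]
  refine integral_mono ?_ hint.integral_prod_right fun y ↦ ?_
  · rw [hswap]
    refine integrable_of_abs_le ((hFm.sub_const _).pow_const 2) (M := (M + M) ^ 2) fun y ↦
      abs_sq_le_of_abs_le ((abs_sub _ _).trans (add_le_add (hFb _) ?_))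
    exact abs_integral_le_of_abs_le hGb
  · have hm : Measurable fun x ↦ f (x + y) - ∫ y, f (x + y) ∂b :=
      hHm.comp (measurable_id.prodMk measurable_const)
    -- Jensen's inequality in `x` for fixed `y`; `hswap` identifies the mean of the centring terms.
    have := sq_integral_le (μ := a) (memLp_two_of_abs_le hm fun x ↦ hHb x y)
    rwa [integral_sub (integrable_of_abs_le (by fun_prop) fun x ↦ hM _)
      (integrable_of_abs_le hGm hGb), ← hswap] at this

/-- Subadditivity of the variance for a sum of independent vectors. -/
lemma variance_conv_le (a b : Measure E) [IsProbabilityMeasure a] [IsProbabilityMeasure b]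
    {f : E → ℝ} (hf : Measurable f) {M : ℝ} (hM : ∀ x, |f x| ≤ M) :
    Var[f; a ∗ b] ≤ ∫ y, Var[fun x ↦ f (x + y); a] ∂b + ∫ x, Var[fun y ↦ f (x + y); b] ∂a := by
  rw [variance_conv a b hf hM]
  gcongr
  exact variance_integral_le a b hf hM

end Convolution

/-! ### Compound Poisson laws as Poisson mixtures of convolution powers. -/

section CompoundPoisson

variable {E : Type*} [NormedAddCommGroup E] [MeasurableSpace E]

/-- Iterated convolution of a measure with itself. -/
noncomputable def convPow (l : Measure E) : ℕ → Measure E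
  | 0 => Measure.dirac 0
  | n + 1 => l ∗ convPow l n

/-- The compound Poisson distribution with finite Lévy measure `l`. -/
noncomputable def compoundPoisson (l : Measure E) : Measure E :=
  Measure.sum fun n ↦
    ENNReal.ofReal (Real.exp (-l.real Set.univ) / n.factorial) • convPow l n

lemma lintegral_compoundPoisson (l : Measure E) (g : E → ℝ≥0∞) :
    ∫⁻ x, g x ∂(compoundPoisson l) = ∑' n : ℕ,
      ENNReal.ofReal (Real.exp (-l.real Set.univ) / n.factorial) * ∫⁻ x, g x ∂(convPow l n) := by
  rw [compoundPoisson, lintegral_sum_measure]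
  simp

variable [BorelSpace E] [SecondCountableTopology E]

instance convPow.instIsFiniteMeasure (l : Measure E) [IsFiniteMeasure l] (n : ℕ) :
    IsFiniteMeasure (convPow l n) := by
  induction n with
  | zero => unfold convPow; infer_instance
  | succ n ih => unfold convPow; infer_instance

variable [InnerProductSpace ℝ E]

lemma charFun_convPow (l : Measure E) [IsFiniteMeasure l] (n : ℕ) (t : E) :
    charFun (convPow l n) t = charFun l t ^ n := by
  induction n with
  | zero => simp [convPow]
  | succ n ih => rw [convPow, charFun_conv, ih, pow_succ']

lemma real_univ_convPow (l : Measure E) [IsFiniteMeasure l] (n : ℕ) :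
    (convPow l n).real Set.univ = l.real Set.univ ^ n := by
  have := charFun_convPow l n 0
  rw [charFun_zero, charFun_zero] at this
  exact_mod_cast this

lemma convPow_univ (l : Measure E) [IsFiniteMeasure l] (n : ℕ) :
    convPow l n Set.univ = ENNReal.ofReal (l.real Set.univ ^ n) := by
  rw [← real_univ_convPow, ofReal_measureReal]

lemma hasSum_exp_neg_mul (m : ℝ) :
    HasSum (fun n : ℕ ↦ Real.exp (-m) / n.factorial * m ^ n) 1 := by
  have h := (NormedSpace.expSeries_div_hasSum_exp m).mul_left (Real.exp (-m))
  rw [← Real.exp_eq_exp_ℝ, ← Real.exp_add, neg_add_cancel, Real.exp_zero] at h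
  convert! h using 2
  ring

instance compoundPoisson.instIsProbabilityMeasure (l : Measure E) [IsFiniteMeasure l] :
    IsProbabilityMeasure (compoundPoisson l) := by
  refine ⟨?_⟩
  have h := hasSum_exp_neg_mul (l.real Set.univ)
  rw [compoundPoisson, Measure.sum_apply _ .univ]
  simp only [Measure.smul_apply, smul_eq_mul, convPow_univ]
  rw [tsum_congr fun n ↦ (ENNReal.ofReal_mul (by positivity)).symm,
    ← ENNReal.ofReal_tsum_of_nonneg (fun n ↦ by positivity) h.summable, h.tsum_eq,
    ENNReal.ofReal_one]

lemma charFun_compoundPoisson (l : Measure E) [IsFiniteMeasure l] (t : E) :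
    charFun (compoundPoisson l) t = Complex.exp (charFun l t - l.real Set.univ) := by
  have hint : Integrable (fun x ↦ Complex.exp (inner ℝ x t * Complex.I)) (compoundPoisson l) :=
    .of_bound (by fun_prop) 1 (.of_forall fun x ↦ by rw [Complex.norm_exp_ofReal_mul_I])
  have h1 := hasSum_integral_measure hint
  have h2 := (NormedSpace.expSeries_div_hasSum_exp (charFun l t)).mul_left
    (Complex.exp (-(l.real Set.univ : ℂ)))
  rw [← Complex.exp_eq_exp_ℂ, ← Complex.exp_add, neg_add_eq_sub] at h2
  refine h1.unique ?_
  convert! h2 using 2 with n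
  rw [integral_smul_measure, ← charFun_apply, charFun_convPow, ENNReal.toReal_ofReal (by positivity),
    Complex.real_smul]
  push_cast
  ring

/-- Characteristic exponents add. This is the infinite divisibility that lets `l` be cut into equal
pieces. -/
lemma compoundPoisson_add [CompleteSpace E] (l₁ l₂ : Measure E) [IsFiniteMeasure l₁]
    [IsFiniteMeasure l₂] :
    compoundPoisson (l₁ + l₂) = compoundPoisson l₁ ∗ compoundPoisson l₂ := by
  refine Measure.ext_of_charFun (funext fun t ↦ ?_)
  have h : charFun (l₁ + l₂) t = charFun l₁ t + charFun l₂ t := by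
    simp only [charFun_apply]
    have hb (l : Measure E) [IsFiniteMeasure l] :
        Integrable (fun x ↦ Complex.exp (inner ℝ x t * Complex.I)) l :=
      .of_bound (by fun_prop) 1 (.of_forall fun x ↦ by rw [Complex.norm_exp_ofReal_mul_I])
    exact integral_add_measure (hb _) (hb _)
  rw [charFun_conv, charFun_compoundPoisson, charFun_compoundPoisson, charFun_compoundPoisson, h,
    ← Complex.exp_add, measureReal_add_apply]
  push_cast
  ring_nf

lemma compoundPoisson_zero [CompleteSpace E] :
    compoundPoisson (0 : Measure E) = Measure.dirac 0 := by
  refine Measure.ext_of_charFun (funext fun t ↦ ?_)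
  rw [charFun_compoundPoisson]
  simp

/-- Keep only the event of no jump. This replaces the energy at a starting point by its average over
the law, at the cost of a factor `exp m`. -/
lemma exp_neg_mul_le_integral_compoundPoisson (l : Measure E) [IsFiniteMeasure l] {g : E → ℝ}
    (hg : Measurable g) (hg0 : ∀ x, 0 ≤ g x) {M : ℝ} (hM : ∀ x, |g x| ≤ M) :
    Real.exp (-l.real Set.univ) * g 0 ≤ ∫ x, g x ∂(compoundPoisson l) := by
  have hle : ENNReal.ofReal (Real.exp (-l.real Set.univ) * g 0) ≤
      ∫⁻ x, ENNReal.ofReal (g x) ∂(compoundPoisson l) := by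
    rw [lintegral_compoundPoisson]
    refine le_trans ?_ (ENNReal.le_tsum 0)
    rw [ENNReal.ofReal_mul (Real.exp_pos _).le]
    simp [convPow]
  rw [← ofReal_integral_eq_lintegral_ofReal (integrable_of_abs_le hg hM) (.of_forall hg0)] at hle
  exact (ENNReal.ofReal_le_ofReal_iff (integral_nonneg hg0)).1 hle

/-- A compound Poisson vector of small intensity makes at most one jump up to a second-order
error. -/
lemma integral_compoundPoisson_le (l : Measure E) [IsFiniteMeasure l] {g : E → ℝ}
    (hg : Measurable g) (hg0 : ∀ x, 0 ≤ g x) (h0 : g 0 = 0) {M : ℝ} (hM : ∀ x, |g x| ≤ M) :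
    ∫ x, g x ∂(compoundPoisson l) ≤ ∫ x, g x ∂l + M * l.real Set.univ ^ 2 := by
  set m := l.real Set.univ with hm
  have hm0 : 0 ≤ m := measureReal_nonneg
  have hM0 : 0 ≤ M := (abs_nonneg _).trans (hM 0)
  have hI := integral_nonneg (μ := l) (f := g) hg0
  rw [← ENNReal.ofReal_le_ofReal_iff (by positivity),
    ofReal_integral_eq_lintegral_ofReal (integrable_of_abs_le hg hM) (.of_forall hg0),
    lintegral_compoundPoisson, ENNReal.ofReal_add hI (by positivity),
    ofReal_integral_eq_lintegral_ofReal (integrable_of_abs_le hg hM) (.of_forall hg0),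
    tsum_eq_zero_add' ENNReal.summable, tsum_eq_zero_add' ENNReal.summable, ← add_assoc]
  have hexp : Real.exp (-m) ≤ 1 := Real.exp_le_one_iff.2 (by linarith)
  refine add_le_add ?_ ?_
  · simp only [convPow, lintegral_dirac' _ (hg.ennreal_ofReal), h0, ENNReal.ofReal_zero, mul_zero,
      zero_add, Measure.conv_dirac_zero, Nat.factorial_one, Nat.cast_one, div_one]
    refine mul_le_of_le_one_left zero_le ?_
    rw [← ENNReal.ofReal_one]
    exact ENNReal.ofReal_le_ofReal hexp
  -- Two or more jumps: since `1 / (n + 2)! ≤ 1 / n!`, the tail is at most `M * m ^ 2` times the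
  -- full sum of Poisson weights, which is 1.
  · have h := (hasSum_exp_neg_mul m).mul_left (M * m ^ 2)
    rw [mul_one] at h
    rw [← h.tsum_eq, ENNReal.ofReal_tsum_of_nonneg (fun n ↦ by positivity) h.summable]
    refine ENNReal.tsum_le_tsum fun n ↦ ?_
    have h1 : ∫⁻ x, ENNReal.ofReal (g x) ∂(convPow l (n + 1 + 1)) ≤
        ENNReal.ofReal (M * m ^ (n + 2)) := by
      rw [ENNReal.ofReal_mul hM0, ← convPow_univ, ← lintegral_const]
      exact lintegral_mono fun x ↦ ENNReal.ofReal_le_ofReal ((le_abs_self _).trans (hM x))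
    refine (mul_le_mul_right h1 _).trans ?_
    rw [← ENNReal.ofReal_mul (by positivity)]
    refine ENNReal.ofReal_le_ofReal ?_
    rw [show M * m ^ 2 * (Real.exp (-m) / n.factorial * m ^ n) =
      Real.exp (-m) / n.factorial * (M * m ^ (n + 2)) by ring]
    gcongr
    omega

end CompoundPoisson

/-! ### The Poincaré inequality for compound Poisson laws. -/

section CompoundPoissonPoincare

variable {E : Type*} [NormedAddCommGroup E] [MeasurableSpace E]

/-- The carré du champ `∫ (f (x + u) - f x)² l(du)` of the jump generator with Lévy measure `l`. -/
noncomputable def jumpEnergy (l : Measure E) (f : E → ℝ) (x : E) : ℝ :=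
  ∫ u, (f (x + u) - f x) ^ 2 ∂l

lemma jumpEnergy_nonneg (l : Measure E) (f : E → ℝ) (x : E) : 0 ≤ jumpEnergy l f x :=
  integral_nonneg fun _ ↦ sq_nonneg _

lemma abs_sub_sq_le {X : Type*} {f : X → ℝ} {M : ℝ} (hM : ∀ x, |f x| ≤ M) (x y : X) :
    |(f x - f y) ^ 2| ≤ (2 * M) ^ 2 := by
  refine abs_sq_le_of_abs_le ((abs_sub _ _).trans ?_)
  linarith [hM x, hM y]

lemma abs_jumpEnergy_le (l : Measure E) [IsFiniteMeasure l] {f : E → ℝ} {M : ℝ}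
    (hM : ∀ x, |f x| ≤ M) (x : E) : |jumpEnergy l f x| ≤ (2 * M) ^ 2 * l.real Set.univ := by
  rw [jumpEnergy, ← Real.norm_eq_abs]
  exact norm_integral_le_of_norm_le_const (.of_forall fun _ ↦ abs_sub_sq_le hM _ _)

lemma jumpEnergy_comp_add (l : Measure E) (f : E → ℝ) (x y : E) :
    jumpEnergy l (fun z ↦ f (z + y)) x = jumpEnergy l f (x + y) := by
  unfold jumpEnergy
  simp_rw [add_right_comm]

variable [BorelSpace E] [SecondCountableTopology E]

lemma measurable_jumpEnergy (l : Measure E) [IsFiniteMeasure l] {f : E → ℝ} (hf : Measurable f) :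
    Measurable (jumpEnergy l f) := by
  refine StronglyMeasurable.measurable
    (StronglyMeasurable.integral_prod_right (f := fun x u ↦ (f (x + u) - f x) ^ 2)
      (Measurable.stronglyMeasurable ?_))
  unfold Function.uncurry
  fun_prop

variable [InnerProductSpace ℝ E]

/-- The second moment about `f 0` has an integrand vanishing when there is no jump, so only the
one-jump term and the second-order error remain. -/
lemma variance_compoundPoisson_le_jumpEnergy_zero (l : Measure E) [IsFiniteMeasure l] {f : E → ℝ}
    (hf : Measurable f) {M : ℝ} (hM : ∀ x, |f x| ≤ M) :
    Var[f; compoundPoisson l] ≤ jumpEnergy l f 0 + (2 * M) ^ 2 * l.real Set.univ ^ 2 := by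
  rw [← variance_sub_const hf.aestronglyMeasurable (f 0)]
  refine (variance_le_expectation_sq (by fun_prop)).trans ?_
  simpa [jumpEnergy] using integral_compoundPoisson_le l (g := fun x ↦ (f x - f 0) ^ 2)
    (by fun_prop) (fun x ↦ sq_nonneg _) (by simp) fun x ↦ abs_sub_sq_le hM _ _

/-- Peel off one copy of `l` at a time by subadditivity of the variance. The error is quadratic in
the mass of `l` but only linear in `n`, so it disappears when `l` is a fraction `1 / n` of a fixed
measure. -/
lemma variance_compoundPoisson_nsmul_le [CompleteSpace E] (l : Measure E) [IsFiniteMeasure l]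
    {M : ℝ} (n : ℕ) {f : E → ℝ} (hf : Measurable f) (hM : ∀ x, |f x| ≤ M) :
    Var[f; compoundPoisson (n • l)] ≤ n * (Real.exp (l.real Set.univ) *
      ∫ x, jumpEnergy l f x ∂(compoundPoisson (n • l)) + (2 * M) ^ 2 * l.real Set.univ ^ 2) := by
  set m := l.real Set.univ with hm
  -- The induction hypothesis is applied to the translates `f (· + y)`, hence the generalization
  -- over `f`.
  induction n generalizing f with
  | zero => simp [compoundPoisson_zero]
  | succ n ih =>
    have hJ := measurable_jumpEnergy l hf
    have hJb := abs_jumpEnergy_le l hM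
    rw [succ_nsmul, compoundPoisson_add]
    set a := compoundPoisson (n • l) with ha
    set b := compoundPoisson l with hb
    refine (variance_conv_le a b hf hM).trans ?_
    have h1 : ∫ y, Var[fun x ↦ f (x + y); a] ∂b ≤ n * (Real.exp m *
        ∫ x, jumpEnergy l f x ∂(a ∗ b) + (2 * M) ^ 2 * m ^ 2) := by
      have hJi := measurable_integral_add_right a hJ
      have hJib : Integrable (fun y ↦ ∫ x, jumpEnergy l f (x + y) ∂a) b :=
        integrable_of_abs_le hJi fun y ↦ abs_integral_le_of_abs_le fun x ↦ hJb _
      calc ∫ y, Var[fun x ↦ f (x + y); a] ∂b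
          ≤ ∫ y, n * (Real.exp m * ∫ x, jumpEnergy l f (x + y) ∂a + (2 * M) ^ 2 * m ^ 2) ∂b := by
            refine integral_mono ?_ (((hJib.const_mul _).add (integrable_const _)).const_mul _)
              fun y ↦ ?_
            · refine integrable_of_abs_le ?_ fun y ↦
                variance_le_sq_of_abs_le (by fun_prop) fun x ↦ hM (x + y)
              simpa only [add_comm] using measurable_variance_add_left a hf hM
            · simpa only [jumpEnergy_comp_add] using
                ih (f := fun x ↦ f (x + y)) (by fun_prop) fun x ↦ hM _
        _ = _ := by
            rw [integral_const_mul, integral_add (hJib.const_mul _) (integrable_const _),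
              integral_const_mul, ← integral_conv_eq' a b hJ hJb]
            simp
    have h2 : ∫ x, Var[fun y ↦ f (x + y); b] ∂a ≤
        Real.exp m * ∫ x, jumpEnergy l f x ∂(a ∗ b) + (2 * M) ^ 2 * m ^ 2 := by
      have hJi : Measurable fun x ↦ ∫ y, jumpEnergy l f (x + y) ∂b := by
        simpa only [add_comm] using measurable_integral_add_right b hJ
      have hJib : Integrable (fun x ↦ ∫ y, jumpEnergy l f (x + y) ∂b) a :=
        integrable_of_abs_le hJi fun y ↦ abs_integral_le_of_abs_le fun x ↦ hJb _
      calc ∫ x, Var[fun y ↦ f (x + y); b] ∂a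
          ≤ ∫ x, (Real.exp m * ∫ y, jumpEnergy l f (x + y) ∂b + (2 * M) ^ 2 * m ^ 2) ∂a := by
            refine integral_mono ?_ ((hJib.const_mul _).add (integrable_const _)) fun x ↦ ?_
            · exact integrable_of_abs_le (measurable_variance_add_left b hf hM) fun x ↦
                variance_le_sq_of_abs_le (by fun_prop) fun y ↦ hM (x + y)
            · have h3 := variance_compoundPoisson_le_jumpEnergy_zero l (f := fun y ↦ f (y + x))
                (by fun_prop) fun y ↦ hM _
              rw [jumpEnergy_comp_add, zero_add] at h3
              have h4 := exp_neg_mul_le_integral_compoundPoisson l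
                (g := fun y ↦ jumpEnergy l f (x + y)) (by fun_prop)
                (fun y ↦ jumpEnergy_nonneg _ _ _) fun y ↦ hJb _
              rw [Real.exp_neg, add_zero, inv_mul_le_iff₀ (Real.exp_pos _)] at h4
              simp only [add_comm x] at h4 ⊢
              linarith
        _ = _ := by
            rw [integral_add (hJib.const_mul _) (integrable_const _),
              integral_const_mul, ← integral_conv_eq a b hJ hJb]
            simp
    push_cast
    linarith

/-- The Poincaré inequality for the compound Poisson distribution, for bounded functions. -/
theorem variance_compoundPoisson_le [CompleteSpace E] (l : Measure E) [IsFiniteMeasure l]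
    {f : E → ℝ} (hf : Measurable f) {M : ℝ} (hM : ∀ x, |f x| ≤ M) :
    Var[f; compoundPoisson l] ≤ ∫ x, jumpEnergy l f x ∂(compoundPoisson l) := by
  set m := l.real Set.univ with hm
  -- Cut `l` into `n + 1` equal pieces of mass `m / (n + 1)`; the `n + 1` squared errors sum to
  -- order `1 / (n + 1)`.
  have key (n : ℕ) : Var[f; compoundPoisson l] ≤
      Real.exp (m * (1 / ((n : ℝ) + 1))) * ∫ x, jumpEnergy l f x ∂(compoundPoisson l)
        + (2 * M) ^ 2 * m ^ 2 * (1 / ((n : ℝ) + 1)) := by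
    have hn : (0 : ℝ) < n + 1 := by positivity
    have hl : (n + 1) • (ENNReal.ofReal (1 / ((n : ℝ) + 1)) • l) = l := by
      rw [← smul_assoc, nsmul_eq_mul, ← ENNReal.ofReal_natCast,
        ← ENNReal.ofReal_mul (by positivity)]
      push_cast
      rw [mul_one_div_cancel hn.ne', ENNReal.ofReal_one, one_smul]
    have : IsFiniteMeasure (ENNReal.ofReal (1 / ((n : ℝ) + 1)) • l) :=
      Measure.smul_finite _ ENNReal.ofReal_ne_top
    have h := variance_compoundPoisson_nsmul_le
      (ENNReal.ofReal (1 / ((n : ℝ) + 1)) • l) (n + 1) hf hM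
    rw [hl] at h
    refine h.trans_eq ?_
    have hJ x : jumpEnergy (ENNReal.ofReal (1 / ((n : ℝ) + 1)) • l) f x =
        1 / ((n : ℝ) + 1) * jumpEnergy l f x := by
      rw [jumpEnergy, integral_smul_measure, ENNReal.toReal_ofReal (by positivity), smul_eq_mul,
        jumpEnergy]
    simp_rw [hJ]
    rw [integral_const_mul, measureReal_ennreal_smul_apply,
      ENNReal.toReal_ofReal (by positivity), ← hm]
    push_cast
    rw [mul_comm (1 / ((n : ℝ) + 1)) m]
    field_simp
  have hlim := tendsto_one_div_add_atTop_nhds_zero_nat (𝕜 := ℝ)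
  have h1 : Filter.Tendsto (fun n : ℕ ↦
      Real.exp (m * (1 / ((n : ℝ) + 1))) * ∫ x, jumpEnergy l f x ∂(compoundPoisson l)
        + (2 * M) ^ 2 * m ^ 2 * (1 / ((n : ℝ) + 1))) Filter.atTop
      (nhds (Real.exp (m * 0) * ∫ x, jumpEnergy l f x ∂(compoundPoisson l)
        + (2 * M) ^ 2 * m ^ 2 * 0)) :=
    ((((Real.continuous_exp.tendsto _).comp (hlim.const_mul m)).mul_const _).add
      (hlim.const_mul _))
  refine (ge_of_tendsto' h1 key).trans_eq ?_
  simp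

end CompoundPoissonPoincare

/-! ### Removing a vanishing independent summand. -/

section SmallRemainder

lemma integral_sq_le_of_eLpNorm_le {Ω : Type*} [MeasurableSpace Ω] {μ : Measure Ω}
    {f : Ω → ℝ} (hf : MemLp f 2 μ) {ε : ℝ} (hε : 0 ≤ ε)
    (h : eLpNorm f 2 μ ≤ ENNReal.ofReal ε) : ∫ x, f x ^ 2 ∂μ ≤ ε ^ 2 := by
  rw [← ENNReal.ofReal_le_ofReal_iff (by positivity),
    ofReal_integral_eq_lintegral_ofReal hf.integrable_sq (.of_forall fun _ ↦ sq_nonneg _)]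
  have h2 := eLpNorm_nnreal_pow_eq_lintegral (f := f) (μ := μ) (p := 2) (by simp)
  have h3 : ∀ x, ENNReal.ofReal (f x ^ 2) = ‖f x‖ₑ ^ ((2 : NNReal) : ℝ) := fun x ↦ by
    rw [← sq_abs, ENNReal.ofReal_pow (abs_nonneg _), Real.enorm_eq_ofReal_abs]
    norm_num
  simp_rw [h3]
  rw [← h2, ENNReal.ofReal_pow hε]
  have h4 : eLpNorm f ((2 : NNReal) : ℝ≥0∞) μ ≤ ENNReal.ofReal ε := by simpa using h
  simpa using ENNReal.rpow_le_rpow h4 (z := 2) (by norm_num)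

variable {E : Type*} [NormedAddCommGroup E] [InnerProductSpace ℝ E] [FiniteDimensional ℝ E]
  [MeasurableSpace E] [BorelSpace E]

/-- The conditional expectation of `f` given a summand `b` is controlled by approximation with a
function `g` whose increments are bounded by `h`. -/
lemma variance_integral_le_approx (a b : Measure E) [IsProbabilityMeasure a]
    [IsProbabilityMeasure b] {f g h : E → ℝ} (hf : Measurable f) (hg : Measurable g)
    (hh : Measurable h) {M B H : ℝ} (hM : ∀ x, |f x| ≤ M) (hB : ∀ x, |g x| ≤ B)
    (hH : ∀ x, |h x| ≤ H) (hgh : ∀ x y, (g (x + y) - g x) ^ 2 ≤ h y) :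
    Var[fun y ↦ ∫ x, f (x + y) ∂a; b] ≤
      2 * ∫ x, (f x - g x) ^ 2 ∂(a ∗ b) + 2 * ∫ y, h y ∂b := by
  have hFm := measurable_integral_add_right a hf
  have hFb : ∀ y, |∫ x, f (x + y) ∂a| ≤ M := fun y ↦ abs_integral_le_of_abs_le fun x ↦ hM _
  have hdm : Measurable fun x ↦ (f x - g x) ^ 2 := by fun_prop
  have hdb : ∀ x, |(f x - g x) ^ 2| ≤ (M + B) ^ 2 := fun x ↦
    abs_sq_le_of_abs_le ((abs_sub _ _).trans (add_le_add (hM _) (hB _)))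
  have hDm := measurable_integral_add_right a hdm
  have hDi : Integrable (fun y ↦ ∫ x, (f (x + y) - g (x + y)) ^ 2 ∂a) b :=
    integrable_of_abs_le hDm fun y ↦ abs_integral_le_of_abs_le fun x ↦ hdb _
  have hhi : Integrable h b := integrable_of_abs_le hh hH
  -- Centre at the constant `∫ g da` and split `f (x + y) - g x` as `(f - g) (x + y) + (g (x + y) -
  -- g x)`; then use Jensen and `(p + q) ^ 2 ≤ 2 * p ^ 2 + 2 * q ^ 2`.
  rw [← variance_sub_const hFm.aestronglyMeasurable (∫ x, g x ∂a)]
  refine (variance_le_expectation_sq (hFm.sub_const _).aestronglyMeasurable).trans ?_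
  rw [integral_conv_eq' a b hdm hdb, ← integral_const_mul, ← integral_const_mul,
    ← integral_add (hDi.const_mul _) (hhi.const_mul _)]
  refine integral_mono ?_ ((hDi.const_mul _).add (hhi.const_mul _)) fun y ↦ ?_
  · exact integrable_of_abs_le (M := (M + B) ^ 2) (by fun_prop) fun y ↦
      abs_sq_le_of_abs_le ((abs_sub _ _).trans
        (add_le_add (hFb _) (abs_integral_le_of_abs_le hB)))
  · have hfi : Integrable (fun x ↦ f (x + y)) a :=
      integrable_of_abs_le (by fun_prop) fun x ↦ hM _
    have hgi : Integrable g a := integrable_of_abs_le hg hB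
    have h1 := sq_integral_le (μ := a) (f := fun x ↦ f (x + y) - g x)
      (memLp_two_of_abs_le (M := M + B) (by fun_prop) fun x ↦
        (abs_sub _ _).trans (add_le_add (hM _) (hB _)))
    rw [integral_sub hfi hgi] at h1
    have hDy : Integrable (fun x ↦ (f (x + y) - g (x + y)) ^ 2) a :=
      integrable_of_abs_le (by fun_prop) fun x ↦ hdb _
    have h2 : ∫ x, (f (x + y) - g x) ^ 2 ∂a ≤
        ∫ x, (2 * (f (x + y) - g (x + y)) ^ 2 + 2 * h y) ∂a := by
      refine integral_mono ?_ ((hDy.const_mul _).add (integrable_const _)) fun x ↦ ?_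
      · exact integrable_of_abs_le (M := (M + B) ^ 2) (by fun_prop) fun x ↦
          abs_sq_le_of_abs_le ((abs_sub _ _).trans (add_le_add (hM _) (hB _)))
      · have := hgh x y
        simp only
        nlinarith [sq_nonneg (f (x + y) - g (x + y) - (g (x + y) - g x))]
    rw [integral_add (hDy.const_mul _) (integrable_const _), integral_const_mul] at h2
    simp only [integral_const, probReal_univ, one_smul] at h2
    exact h1.trans h2

/-- Measures whose characteristic functions tend to `1` concentrate at the origin. -/
lemma tendsto_integral_of_tendsto_charFun_one {ρ : ℕ → Measure E}
    [∀ n, IsProbabilityMeasure (ρ n)]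
    (hρ : ∀ t, Filter.Tendsto (fun n ↦ charFun (ρ n) t) Filter.atTop (nhds 1))
    (h : BoundedContinuousFunction E ℝ) :
    Filter.Tendsto (fun n ↦ ∫ y, h y ∂(ρ n)) Filter.atTop (nhds (h 0)) := by
  let ρ' : ℕ → ProbabilityMeasure E := fun n ↦ ⟨ρ n, inferInstance⟩
  let δ : ProbabilityMeasure E := ⟨Measure.dirac 0, inferInstance⟩
  have key : Filter.Tendsto ρ' Filter.atTop (nhds δ) := by
    refine ProbabilityMeasure.tendsto_of_tendsto_charFun fun t ↦ ?_
    simpa [ρ', δ] using hρ t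
  rw [ProbabilityMeasure.tendsto_iff_forall_integral_tendsto] at key
  simpa [ρ', δ] using key h

/-- A probability measure which is, up to a vanishing independent summand, compound Poisson with
Lévy measure `l n` satisfies the Poincaré inequality of the limiting jump energy. -/
theorem variance_le_of_conv_compoundPoisson {μ : Measure E} [IsProbabilityMeasure μ]
    {ρ l : ℕ → Measure E} [∀ n, IsProbabilityMeasure (ρ n)] [∀ n, IsFiniteMeasure (l n)]
    (hμ : ∀ n, compoundPoisson (l n) ∗ ρ n = μ)
    (hρ : ∀ t, Filter.Tendsto (fun n ↦ charFun (ρ n) t) Filter.atTop (nhds 1))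
    {f : E → ℝ} (hf : Measurable f) {M : ℝ} (hM : ∀ x, |f x| ≤ M) {C : ℝ}
    (hC : ∀ n, ∫ x, jumpEnergy (l n) f x ∂μ ≤ C) : Var[f; μ] ≤ C := by
  refine le_of_forall_pos_le_add fun η hη ↦ ?_
  -- The tolerance `√(η / 2)` makes `2 ∫ (f - g) ^ 2 dμ` at most `η`.
  obtain ⟨g, hgs, hgd, hg⟩ := (memLp_two_of_abs_le (μ := μ) hf hM).exist_eLpNorm_sub_le
    (by simp) (by norm_num) (Real.sqrt_pos.2 (half_pos hη))
  obtain ⟨B, hB⟩ := hgd.continuous.bounded_above_of_compact_support hgs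
  obtain ⟨K, hK⟩ := hgd.lipschitzWith_of_hasCompactSupport hgs (by simp)
  have hB0 : 0 ≤ B := (norm_nonneg _).trans (hB 0)
  have hgm : Measurable g := hgd.continuous.measurable
  have hfg := integral_sq_le_of_eLpNorm_le
    ((memLp_two_of_abs_le (μ := μ) hf hM).sub (memLp_two_of_abs_le hgm hB)) (Real.sqrt_nonneg _) hg
  rw [Real.sq_sqrt (half_pos hη).le] at hfg
  -- A bounded continuous majorant of the squared increments of `g`, zero at the origin: Lipschitz
  -- bound for short increments, sup bound for long ones.
  let h : BoundedContinuousFunction E ℝ := BoundedContinuousFunction.ofNormedAddCommGroup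
    (fun y ↦ min ((K * ‖y‖) ^ 2) ((2 * B) ^ 2)) (by fun_prop) ((2 * B) ^ 2) fun y ↦ by
      rw [Real.norm_of_nonneg (by positivity)]
      exact min_le_right _ _
  have hgh (x y : E) : (g (x + y) - g x) ^ 2 ≤ h y := by
    refine le_min ?_ ((le_abs_self _).trans (abs_sub_sq_le hB _ _))
    rw [← sq_abs]
    gcongr
    simpa [dist_eq_norm] using hK.dist_le_mul (x + y) x
  have hbound (n : ℕ) : Var[f; μ] ≤ C + (η + 2 * ∫ y, h y ∂(ρ n)) := by
    have hJ := measurable_jumpEnergy (l n) hf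
    have hJb := abs_jumpEnergy_le (l n) hM
    have h1 := variance_conv (compoundPoisson (l n)) (ρ n) hf hM
    have h2 := variance_integral_le_approx (compoundPoisson (l n)) (ρ n) hf hgm
      h.continuous.measurable hM hB (fun x ↦ h.norm_coe_le_norm x) hgh
    have h3 : ∫ y, Var[fun x ↦ f (x + y); compoundPoisson (l n)] ∂(ρ n) ≤
        ∫ y, ∫ x, jumpEnergy (l n) f (x + y) ∂(compoundPoisson (l n)) ∂(ρ n) := by
      refine integral_mono ?_ ?_ fun y ↦ ?_
      · refine integrable_of_abs_le ?_ fun y ↦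
          variance_le_sq_of_abs_le (by fun_prop) fun x ↦ hM (x + y)
        simpa only [add_comm] using measurable_variance_add_left (compoundPoisson (l n)) hf hM
      · exact integrable_of_abs_le (measurable_integral_add_right _ hJ) fun y ↦
          abs_integral_le_of_abs_le fun x ↦ hJb _
      · simpa only [jumpEnergy_comp_add] using variance_compoundPoisson_le (l n)
          (f := fun x ↦ f (x + y)) (by fun_prop) fun x ↦ hM _
    rw [← integral_conv_eq' _ _ hJ hJb, hμ] at h3
    rw [hμ] at h1 h2
    simp only [Pi.sub_apply] at hfg
    linarith [hC n]
  have hlim := ((tendsto_integral_of_tendsto_charFun_one hρ h).const_mul 2).const_add η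
  refine (ge_of_tendsto' (hlim.const_add C) hbound).trans_eq ?_
  simp [h, sq_nonneg]

end SmallRemainder

/-! ### The stable Lévy measure and its characteristic exponent. -/

section StableLevyMeasure

lemma lintegral_ofReal_of_integral_ne_zero {Ω : Type*} [MeasurableSpace Ω] {μ : Measure Ω}
    {f : Ω → ℝ} (hf : 0 ≤ᵐ[μ] f) (h : ∫ x, f x ∂μ ≠ 0) :
    ∫⁻ x, ENNReal.ofReal (f x) ∂μ = ENNReal.ofReal (∫ x, f x ∂μ) :=
  (ofReal_integral_eq_lintegral_ofReal (.of_integral_ne_zero h) hf).symm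

/-- With `r = ‖u‖ ^ 2` and `p = (d + α) / 2`, this writes `‖u‖ ^ (-(d + α))` as a mixture of
Gaussians in `u`. -/
lemma lintegral_rpow_mul_exp_neg_mul {p r : ℝ} (hp : 0 < p) (hr : 0 < r) :
    ∫⁻ s in Set.Ioi (0 : ℝ), ENNReal.ofReal (s ^ (p - 1) * Real.exp (-(r * s))) =
      ENNReal.ofReal (Real.Gamma p / r ^ p) := by
  have h := Real.integral_rpow_mul_exp_neg_mul_Ioi hp hr
  have hpos : 0 < (1 / r) ^ p * Real.Gamma p := mul_pos (by positivity) (Real.Gamma_pos_of_pos hp)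
  rw [lintegral_ofReal_of_integral_ne_zero _ (h ▸ hpos.ne'), h]
  · rw [Real.div_rpow zero_le_one hr.le, Real.one_rpow, one_div_mul_eq_div]
  · filter_upwards [ae_restrict_mem measurableSet_Ioi] with s hs
    have : (0 : ℝ) < s := hs
    positivity

/-- The substitution `s ↦ 1 / s` in Euler's integral. -/
lemma lintegral_rpow_mul_exp_neg_div {β r : ℝ} (hβ : β < 1) (hr : 0 < r) :
    ∫⁻ s in Set.Ioi (0 : ℝ), ENNReal.ofReal (s ^ (β - 2) * Real.exp (-(r / s))) =
      ENNReal.ofReal (Real.Gamma (1 - β) * r ^ (β - 1)) := by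
  have h := Real.integral_rpow_mul_exp_neg_mul_Ioi (sub_pos.2 hβ) hr
  rw [← integral_comp_rpow_Ioi _ (by norm_num : (-1 : ℝ) ≠ 0)] at h
  have h2 : ∫ s in Set.Ioi (0 : ℝ), s ^ (β - 2) * Real.exp (-(r / s)) =
      (1 / r) ^ (1 - β) * Real.Gamma (1 - β) := by
    rw [← h]
    refine setIntegral_congr_fun measurableSet_Ioi fun s hs ↦ ?_
    have hs : (0 : ℝ) < s := hs
    simp only [abs_neg, abs_one, one_mul, smul_eq_mul]
    rw [← Real.rpow_mul hs.le, ← mul_assoc, ← Real.rpow_add hs, Real.rpow_neg_one, div_eq_mul_inv]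
    ring_nf
  have hpos : 0 < (1 / r) ^ (1 - β) * Real.Gamma (1 - β) :=
    mul_pos (by positivity) (Real.Gamma_pos_of_pos (sub_pos.2 hβ))
  rw [lintegral_ofReal_of_integral_ne_zero _ (h2 ▸ hpos.ne'), h2]
  · rw [one_div, Real.inv_rpow hr.le, ← Real.rpow_neg hr.le, neg_sub, mul_comm]
  · filter_upwards [ae_restrict_mem measurableSet_Ioi] with s hs
    have : (0 : ℝ) < s := hs
    positivity

lemma lintegral_exp_neg_div {s b : ℝ} (hs : 0 < s) (hb : 0 ≤ b) :
    ∫⁻ r in Set.Ioc 0 b, ENNReal.ofReal (Real.exp (-(r / s))) =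
      ENNReal.ofReal (s * (1 - Real.exp (-(b / s)))) := by
  rw [← ofReal_integral_eq_lintegral_ofReal
    (Continuous.integrableOn_Ioc (by fun_prop)) (.of_forall fun _ ↦ (Real.exp_pos _).le),
    ← intervalIntegral.integral_of_le hb,
    intervalIntegral.integral_eq_sub_of_hasDerivAt (f := fun r ↦ -s * Real.exp (-(r / s)))]
  · congr 1
    simp
    ring
  · intro r _
    have := (((hasDerivAt_id r).div_const s).neg.exp).const_mul (-s)
    convert! this using 1
    field_simp
    simp
  · exact Continuous.intervalIntegrable (by fun_prop) _ _

/-- Write `s * (1 - exp (-(b / s)))` as `∫ exp (-(r / s)) dr` over `0 < r ≤ b` and apply Tonelli. -/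
lemma lintegral_rpow_mul_one_sub_exp {β b : ℝ} (hβ0 : 0 < β) (hβ : β < 1) (hb : 0 ≤ b) :
    ∫⁻ s in Set.Ioi (0 : ℝ), ENNReal.ofReal (s ^ (β - 1) * (1 - Real.exp (-(b / s)))) =
      ENNReal.ofReal (Real.Gamma (1 - β) * (b ^ β / β)) := by
  calc ∫⁻ s in Set.Ioi (0 : ℝ), ENNReal.ofReal (s ^ (β - 1) * (1 - Real.exp (-(b / s))))
      = ∫⁻ s in Set.Ioi (0 : ℝ), ∫⁻ r in Set.Ioc 0 b,
          ENNReal.ofReal (s ^ (β - 2) * Real.exp (-(r / s))) := by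
        refine setLIntegral_congr_fun measurableSet_Ioi fun s hs ↦ ?_
        have hs : (0 : ℝ) < s := hs
        have h0 : (0 : ℝ) ≤ s ^ (β - 2) := by positivity
        simp_rw [ENNReal.ofReal_mul h0]
        rw [lintegral_const_mul _ (by fun_prop), lintegral_exp_neg_div hs hb,
          ← ENNReal.ofReal_mul h0, ← mul_assoc, ← Real.rpow_add_one hs.ne']
        ring_nf
    _ = ∫⁻ r in Set.Ioc 0 b, ∫⁻ s in Set.Ioi (0 : ℝ),
          ENNReal.ofReal (s ^ (β - 2) * Real.exp (-(r / s))) := by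
        refine lintegral_lintegral_swap (Measurable.aemeasurable ?_)
        unfold Function.uncurry
        fun_prop
    _ = ∫⁻ r in Set.Ioc 0 b, ENNReal.ofReal (Real.Gamma (1 - β) * r ^ (β - 1)) :=
        setLIntegral_congr_fun measurableSet_Ioc fun r hr ↦
          lintegral_rpow_mul_exp_neg_div hβ hr.1
    _ = _ := by
        have hG := (Real.Gamma_pos_of_pos (sub_pos.2 hβ)).le
        have hi : IntervalIntegrable (fun r : ℝ ↦ r ^ (β - 1)) volume 0 b :=
          intervalIntegral.intervalIntegrable_rpow' (by linarith)
        simp_rw [ENNReal.ofReal_mul hG]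
        rw [lintegral_const_mul _ (by fun_prop), ← ofReal_integral_eq_lintegral_ofReal
          ((intervalIntegrable_iff_integrableOn_Ioc_of_le hb).1 hi),
          ← intervalIntegral.integral_of_le hb, integral_rpow (Or.inl (by linarith))]
        · simp [Real.zero_rpow hβ0.ne']
        · filter_upwards [ae_restrict_mem measurableSet_Ioc] with r hr
          exact Real.rpow_nonneg hr.1.le _

lemma lintegral_one_sub_cos_mul_exp {V : Type*} [NormedAddCommGroup V] [InnerProductSpace ℝ V]
    [FiniteDimensional ℝ V] [MeasurableSpace V] [BorelSpace V] (ξ : V) {s : ℝ} (hs : 0 < s) :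
    ∫⁻ u : V, ENNReal.ofReal ((1 - Real.cos (inner ℝ u ξ)) * Real.exp (-s * ‖u‖ ^ 2)) =
      ENNReal.ofReal ((Real.pi / s) ^ (Module.finrank ℝ V / 2 : ℝ) *
        (1 - Real.exp (-(‖ξ‖ ^ 2 / 4 / s)))) := by
  have hs' : 0 < (s : ℂ).re := hs
  have h0 := GaussianFourier.integrable_cexp_neg_mul_sq_norm_add hs' 0 ξ
  have h1 := GaussianFourier.integrable_cexp_neg_mul_sq_norm_add hs' Complex.I ξ
  have h2 := GaussianFourier.integral_cexp_neg_mul_sq_norm_add hs' Complex.I ξ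
  have hpt (u : V) : (1 - Real.cos (inner ℝ u ξ)) * Real.exp (-s * ‖u‖ ^ 2) =
      Real.exp (-s * ‖u‖ ^ 2) -
        (Complex.exp (-s * ‖u‖ ^ 2 + Complex.I * inner ℝ ξ u)).re := by
    rw [Complex.exp_re]
    simp [real_inner_comm, ← Complex.ofReal_pow]
    ring
  have hi0 : Integrable fun u : V ↦ Real.exp (-s * ‖u‖ ^ 2) := by
    refine h0.re.congr (.of_forall fun u ↦ ?_)
    simp [Complex.exp_re, ← Complex.ofReal_pow]
  have hi1 : Integrable fun u : V ↦
      (Complex.exp (-s * ‖u‖ ^ 2 + Complex.I * inner ℝ ξ u)).re := h1.re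
  have hre : ∫ u : V, (Complex.exp (-s * ‖u‖ ^ 2 + Complex.I * inner ℝ ξ u)).re =
      (Real.pi / s) ^ (Module.finrank ℝ V / 2 : ℝ) * Real.exp (-(‖ξ‖ ^ 2 / 4 / s)) := by
    have h3 := integral_re h1
    simp only [RCLike.re_eq_complex_re] at h3
    rw [h3, h2]
    have h4 : ((Real.pi : ℂ) / s) ^ (Module.finrank ℝ V / 2 : ℂ) *
        Complex.exp (Complex.I ^ 2 * ‖ξ‖ ^ 2 / (4 * s)) =
        (((Real.pi / s) ^ (Module.finrank ℝ V / 2 : ℝ) *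
          Real.exp (-(‖ξ‖ ^ 2 / 4 / s)) : ℝ) : ℂ) := by
      rw [Complex.I_sq]
      push_cast
      rw [Complex.ofReal_cpow (by positivity)]
      push_cast
      congr 2
      field_simp
    rw [h4, Complex.ofReal_re]
  rw [← ofReal_integral_eq_lintegral_ofReal]
  · simp_rw [hpt]
    rw [integral_sub hi0 hi1, GaussianFourier.integral_rexp_neg_mul_sq_norm hs, hre]
    ring_nf
  · simp_rw [hpt]
    exact hi0.sub hi1
  · exact .of_forall fun u ↦ mul_nonneg (sub_nonneg.2 (Real.cos_le_one _)) (Real.exp_pos _).le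

/-- The characteristic exponent of the measure `‖u‖^(-d-α) du`. -/
lemma lintegral_one_sub_cos_mul_rpow {V : Type*} [NormedAddCommGroup V] [InnerProductSpace ℝ V]
    [FiniteDimensional ℝ V] [MeasurableSpace V] [BorelSpace V] {α : ℝ} (hα₀ : 0 < α) (hα₂ : α < 2)
    (ξ : V) :
    ∫⁻ u : V, ENNReal.ofReal ((1 - Real.cos (inner ℝ u ξ)) *
        (Real.Gamma ((Module.finrank ℝ V + α) / 2) / ‖u‖ ^ (Module.finrank ℝ V + α))) =
      ENNReal.ofReal (Real.pi ^ (Module.finrank ℝ V / 2 : ℝ) *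
        (Real.Gamma (1 - α / 2) * ((‖ξ‖ ^ 2 / 4) ^ (α / 2) / (α / 2)))) := by
  set d : ℝ := ((Module.finrank ℝ V : ℕ) : ℝ) with hd
  have hd0 : 0 ≤ d := by positivity
  set p : ℝ := (d + α) / 2 with hp
  have hp0 : 0 < p := by positivity
  have hcos (u : V) : 0 ≤ 1 - Real.cos (inner ℝ u ξ) := sub_nonneg.2 (Real.cos_le_one _)
  calc ∫⁻ u : V, ENNReal.ofReal ((1 - Real.cos (inner ℝ u ξ)) * (Real.Gamma p / ‖u‖ ^ (d + α)))
      = ∫⁻ u : V, ∫⁻ s in Set.Ioi (0 : ℝ), ENNReal.ofReal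
          ((1 - Real.cos (inner ℝ u ξ)) * (s ^ (p - 1) * Real.exp (-(‖u‖ ^ 2 * s)))) := by
        refine lintegral_congr fun u ↦ ?_
        simp_rw [ENNReal.ofReal_mul (hcos u)]
        rw [lintegral_const_mul _ (by fun_prop)]
        -- At the origin the factor `1 - cos` vanishes, so the singularity of the density does not
        -- matter.
        rcases eq_or_ne u 0 with rfl | hu
        · simp
        · rw [lintegral_rpow_mul_exp_neg_mul hp0 (by positivity), ← Real.rpow_natCast_mul
            (norm_nonneg _)]
          congr 4
          rw [hp]
          push_cast
          ring
    _ = ∫⁻ s in Set.Ioi (0 : ℝ), ∫⁻ u : V, ENNReal.ofReal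
          ((1 - Real.cos (inner ℝ u ξ)) * (s ^ (p - 1) * Real.exp (-(‖u‖ ^ 2 * s)))) := by
        refine lintegral_lintegral_swap (Measurable.aemeasurable ?_)
        unfold Function.uncurry
        fun_prop
    _ = ∫⁻ s in Set.Ioi (0 : ℝ), ENNReal.ofReal (Real.pi ^ (d / 2)) *
          ENNReal.ofReal (s ^ (α / 2 - 1) * (1 - Real.exp (-(‖ξ‖ ^ 2 / 4 / s)))) := by
        refine setLIntegral_congr_fun measurableSet_Ioi fun s hs ↦ ?_
        have hs : (0 : ℝ) < s := hs
        have h0 : (0 : ℝ) ≤ s ^ (p - 1) := by positivity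
        have hre (u : V) : (1 - Real.cos (inner ℝ u ξ)) *
            (s ^ (p - 1) * Real.exp (-(‖u‖ ^ 2 * s))) =
            s ^ (p - 1) * ((1 - Real.cos (inner ℝ u ξ)) * Real.exp (-s * ‖u‖ ^ 2)) := by
          rw [show -(‖u‖ ^ 2 * s) = -s * ‖u‖ ^ 2 by ring]
          ring
        simp_rw [hre, ENNReal.ofReal_mul h0]
        rw [lintegral_const_mul _ (by fun_prop), lintegral_one_sub_cos_mul_exp ξ hs,
          ← ENNReal.ofReal_mul h0, ← ENNReal.ofReal_mul (by positivity), ← hd,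
          Real.div_rpow Real.pi_pos.le hs.le]
        congr 1
        have : s ^ (p - 1) = s ^ (α / 2 - 1) * s ^ (d / 2) := by
          rw [← Real.rpow_add hs, hp]
          ring_nf
        rw [this]
        have : s ^ (d / 2) ≠ 0 := (Real.rpow_pos_of_pos hs _).ne'
        field_simp
    _ = _ := by
        rw [lintegral_const_mul _ (by fun_prop), lintegral_rpow_mul_one_sub_exp (by positivity)
          (by linarith) (by positivity), ← ENNReal.ofReal_mul (by positivity)]

lemma cos_mul_pi_div_two_neg {α : ℝ} (hα₁ : 1 < α) (hα₂ : α < 2) :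
    Real.cos (α * Real.pi / 2) < 0 :=
  Real.cos_neg_of_pi_div_two_lt_of_lt (by nlinarith [Real.pi_pos]) (by nlinarith [Real.pi_pos])

lemma stableConst_pos (d : ℕ) {α : ℝ} (hα₁ : 1 < α) (hα₂ : α < 2) : 0 < stableConst d α := by
  unfold stableConst
  have hc := cos_mul_pi_div_two_neg hα₁ hα₂
  have h1 : 0 < Real.Gamma ((α + d) / 2) := Real.Gamma_pos_of_pos (by positivity)
  have h2 : 0 < Real.Gamma ((α + 1) / 2) := Real.Gamma_pos_of_pos (by positivity)
  have h3 : 0 < Real.Gamma (2 - α) := Real.Gamma_pos_of_pos (by linarith)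
  have h4 : 0 < Real.pi ^ (((d : ℝ) - 1) / 2) := by positivity
  refine div_pos_of_neg_of_neg ?_ ?_
  · have : 0 < α * (α - 1) := mul_pos (by linarith) (by linarith)
    nlinarith
  · rw [mul_assoc, mul_assoc, mul_assoc]
    exact mul_neg_of_pos_of_neg (by norm_num) (mul_neg_of_neg_of_pos hc (by positivity))

/-- Legendre duplication at `1 - α / 2` and reflection at `(α + 1) / 2`, linked by `Γ(s + 1) = s
Γ(s)` at `s = (1 - α) / 2`. -/
lemma sqrt_pi_mul_Gamma_eq {α : ℝ} (hα₁ : 1 < α) (hα₂ : α < 2) :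
    (1 - α) * (√Real.pi * Real.Gamma (1 - α / 2)) =
      Real.cos (α * Real.pi / 2) * Real.Gamma ((α + 1) / 2) * Real.Gamma (2 - α) * 2 ^ α := by
  have hc := (cos_mul_pi_div_two_neg hα₁ hα₂).ne
  have h1 := Real.Gamma_mul_Gamma_add_half (1 - α / 2)
  have h2 := Real.Gamma_add_one (s := (1 - α) / 2) (by intro h; linarith)
  have h3 := Real.Gamma_mul_Gamma_one_sub ((α + 1) / 2)
  rw [show Real.pi * ((α + 1) / 2) = α * Real.pi / 2 + Real.pi / 2 by ring,
    Real.sin_add_pi_div_two, show 1 - (α + 1) / 2 = (1 - α) / 2 by ring, eq_div_iff hc] at h3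
  rw [show 1 - α / 2 + 1 / 2 = (1 - α) / 2 + 1 by ring, show 2 * (1 - α / 2) = 2 - α by ring,
    show 1 - (2 - α) = α - 1 by ring, Real.rpow_sub_one two_ne_zero] at h1
  have h4 : Real.Gamma ((1 - α) / 2 + 1) ≠ 0 := (Real.Gamma_pos_of_pos (by linarith)).ne'
  refine mul_right_cancel₀ h4 ?_
  calc (1 - α) * (√Real.pi * Real.Gamma (1 - α / 2)) * Real.Gamma ((1 - α) / 2 + 1)
      = (1 - α) * √Real.pi * (Real.Gamma (1 - α / 2) * Real.Gamma ((1 - α) / 2 + 1)) := by ring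
    _ = (1 - α) * Real.Gamma (2 - α) * (2 ^ α / 2) * (√Real.pi * √Real.pi) := by rw [h1]; ring
    _ = (1 - α) * Real.Gamma (2 - α) * (2 ^ α / 2) * Real.pi := by
        rw [Real.mul_self_sqrt Real.pi_pos.le]
    _ = _ := by
        rw [h2]
        linear_combination -((1 - α) * Real.Gamma (2 - α) * (2 ^ α / 2)) * h3

/-- The normalization check: `c_{α,d}` is exactly the constant giving the exponent `‖ξ‖^α / 2`. -/
lemma stableConst_mul (d : ℕ) {α : ℝ} (hα₁ : 1 < α) (hα₂ : α < 2) {r : ℝ} (hr : 0 ≤ r) :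
    stableConst d α / Real.Gamma ((d + α) / 2) * (Real.pi ^ (d / 2 : ℝ) *
      (Real.Gamma (1 - α / 2) * ((r ^ 2 / 4) ^ (α / 2) / (α / 2)))) = r ^ α / 2 := by
  have hα0 : α ≠ 0 := by linarith
  have hc := (cos_mul_pi_div_two_neg hα₁ hα₂).ne
  have h1 : Real.Gamma ((d + α) / 2) ≠ 0 := (Real.Gamma_pos_of_pos (by positivity)).ne'
  have h2 : Real.Gamma ((α + 1) / 2) ≠ 0 := (Real.Gamma_pos_of_pos (by positivity)).ne'
  have h3 : Real.Gamma (2 - α) ≠ 0 := (Real.Gamma_pos_of_pos (by linarith)).ne'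
  have h4 : Real.pi ^ (((d : ℝ) - 1) / 2) ≠ 0 := by positivity
  have h5 : Real.pi ^ (d / 2 : ℝ) = Real.pi ^ (((d : ℝ) - 1) / 2) * √Real.pi := by
    rw [Real.sqrt_eq_rpow, ← Real.rpow_add Real.pi_pos]
    ring_nf
  have h6 : (r ^ 2 / 4) ^ (α / 2) = r ^ α / 2 ^ α := by
    rw [show r ^ 2 / 4 = (r / 2) ^ 2 by ring, ← Real.rpow_natCast_mul (by positivity),
      show ((2 : ℕ) : ℝ) * (α / 2) = α by push_cast; ring, Real.div_rpow hr (by norm_num)]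
  have h7 : (2 : ℝ) ^ α ≠ 0 := by positivity
  have h8 := sqrt_pi_mul_Gamma_eq hα₁ hα₂
  rw [h5, h6, stableConst, add_comm α (d : ℝ)]
  calc -α * (α - 1) * Real.Gamma ((d + α) / 2) / (4 * Real.cos (α * Real.pi / 2) *
        Real.Gamma ((α + 1) / 2) * Real.pi ^ (((d : ℝ) - 1) / 2) * Real.Gamma (2 - α)) /
        Real.Gamma ((d + α) / 2) * (Real.pi ^ (((d : ℝ) - 1) / 2) * √Real.pi *
        (Real.Gamma (1 - α / 2) * (r ^ α / 2 ^ α / (α / 2))))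
      = (1 - α) * (√Real.pi * Real.Gamma (1 - α / 2)) * r ^ α / (2 * (Real.cos (α * Real.pi / 2) *
        Real.Gamma ((α + 1) / 2) * Real.Gamma (2 - α) * 2 ^ α)) := by
        field_simp
        ring
    _ = r ^ α / 2 := by
        rw [h8]
        field_simp

variable {d : ℕ} {α : ℝ}

local notation "V" => EuclideanSpace ℝ (Fin d)

lemma lintegral_stableLevyMeasure (F : V → ℝ≥0∞) (hF : Measurable F) :
    ∫⁻ u, F u ∂(stableLevyMeasure d α) =
      ∫⁻ u, ENNReal.ofReal (stableConst d α / ‖u‖ ^ ((d : ℝ) + α)) * F u := by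
  rw [stableLevyMeasure, lintegral_withDensity_eq_lintegral_mul _ (by fun_prop) hF]
  rfl

lemma lintegral_one_sub_cos_stableLevyMeasure (hα₁ : 1 < α) (hα₂ : α < 2) (ξ : V) :
    ∫⁻ u, ENNReal.ofReal (1 - Real.cos (inner ℝ u ξ)) ∂(stableLevyMeasure d α) =
      ENNReal.ofReal (‖ξ‖ ^ α / 2) := by
  have hc := stableConst_pos d hα₁ hα₂
  have hG : 0 < Real.Gamma ((d + α) / 2) := Real.Gamma_pos_of_pos (by positivity)
  have h := lintegral_one_sub_cos_mul_rpow (by linarith : 0 < α) hα₂ ξ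
  simp only [finrank_euclideanSpace, Fintype.card_fin] at h
  rw [lintegral_stableLevyMeasure _ (by fun_prop), ← stableConst_mul d hα₁ hα₂ (norm_nonneg ξ),
    ENNReal.ofReal_mul (by positivity), ← h, ← lintegral_const_mul _ (by fun_prop)]
  refine lintegral_congr fun u ↦ ?_
  rw [← ENNReal.ofReal_mul (by positivity), ← ENNReal.ofReal_mul (by positivity)]
  congr 1
  field_simp

lemma integrable_one_sub_cos (hα₁ : 1 < α) (hα₂ : α < 2) (ξ : V) :
    Integrable (fun u ↦ 1 - Real.cos (inner ℝ u ξ)) (stableLevyMeasure d α) := by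
  refine ⟨by fun_prop, ?_⟩
  rw [hasFiniteIntegral_iff_ofReal (.of_forall fun u ↦ sub_nonneg.2 (Real.cos_le_one _)),
    lintegral_one_sub_cos_stableLevyMeasure hα₁ hα₂]
  exact ENNReal.ofReal_lt_top

lemma integral_one_sub_cos (hα₁ : 1 < α) (hα₂ : α < 2) (ξ : V) :
    ∫ u, (1 - Real.cos (inner ℝ u ξ)) ∂(stableLevyMeasure d α) = ‖ξ‖ ^ α / 2 := by
  rw [integral_eq_lintegral_of_nonneg_ae (.of_forall fun u ↦ sub_nonneg.2 (Real.cos_le_one _))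
    (by fun_prop), lintegral_one_sub_cos_stableLevyMeasure hα₁ hα₂,
    ENNReal.toReal_ofReal (by positivity)]

/-- Away from the origin `‖u‖ ≥ ε / (1 + ε) * (1 + ‖u‖)`, so the density is dominated by a multiple
of the integrable `(1 + ‖u‖) ^ (-(d + α))`. -/
lemma stableLevyMeasure_lt_top (hα₁ : 1 < α) (hα₂ : α < 2) {ε : ℝ} (hε : 0 < ε) :
    stableLevyMeasure d α {u | ε < ‖u‖} < ∞ := by
  have hc := stableConst_pos d hα₁ hα₂
  have hm : MeasurableSet {u : V | ε < ‖u‖} := measurableSet_lt (by fun_prop) (by fun_prop)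
  set r : ℝ := (d : ℝ) + α with hr
  have hr0 : 0 < r := by positivity
  have hint : Integrable fun u : V ↦ stableConst d α * (ε / (1 + ε)) ^ (-r) * (1 + ‖u‖) ^ (-r) :=
    (integrable_one_add_norm (by simp [hr]; linarith)).const_mul _
  rw [stableLevyMeasure, withDensity_apply _ hm]
  refine lt_of_le_of_lt ?_ ((hasFiniteIntegral_iff_ofReal
    (.of_forall fun u ↦ by positivity)).1 hint.2)
  refine le_trans (setLIntegral_mono (by fun_prop) fun u hu ↦ ?_) (setLIntegral_le_lintegral _ _)
  have hu : ε < ‖u‖ := hu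
  have hu0 : 0 < ‖u‖ := hε.trans hu
  refine ENNReal.ofReal_le_ofReal ?_
  rw [div_eq_mul_inv, mul_assoc, ← Real.rpow_neg hu0.le, ← Real.mul_rpow (by positivity)
    (by positivity)]
  refine mul_le_mul_of_nonneg_left ?_ hc.le
  refine Real.rpow_le_rpow_of_nonpos (by positivity) ?_ (by linarith)
  rw [div_mul_eq_mul_div, div_le_iff₀ (by positivity)]
  nlinarith

instance stableLevyMeasure.instIsNegInvariant : (stableLevyMeasure d α).IsNegInvariant := by
  refine ⟨Measure.ext fun s hs ↦ ?_⟩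
  rw [Measure.neg, Measure.map_apply measurable_neg hs, stableLevyMeasure,
    withDensity_apply _ hs, withDensity_apply _ (measurable_neg hs),
    ← lintegral_indicator hs, ← lintegral_indicator (measurable_neg hs),
    ← lintegral_neg_eq_self]
  refine lintegral_congr fun u ↦ ?_
  by_cases hu : u ∈ s <;> simp [Set.indicator, hu]

/-- By symmetry of `S` and of the Lévy measure the sine part integrates to zero, leaving a real
exponent. -/
lemma charFun_compoundPoisson_restrict {S : Set V} (hS : MeasurableSet S)
    (hsymm : ∀ u, -u ∈ S ↔ u ∈ S) (hfin : stableLevyMeasure d α S < ∞) (t : V) :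
    charFun (compoundPoisson ((stableLevyMeasure d α).restrict S)) t =
      ((Real.exp (-∫ u in S, (1 - Real.cos (inner ℝ u t)) ∂(stableLevyMeasure d α)) : ℝ) : ℂ) := by
  have : IsFiniteMeasure ((stableLevyMeasure d α).restrict S) := ⟨by simpa using hfin⟩
  set l := (stableLevyMeasure d α).restrict S with hl
  have hsin : ∫ u, Real.sin (inner ℝ u t) ∂l = 0 := by
    rw [hl, ← integral_indicator hS]
    have h := integral_neg_eq_self (S.indicator fun u : V ↦ Real.sin (inner ℝ u t))
      (stableLevyMeasure d α)
    have hodd (u : V) : S.indicator (fun u : V ↦ Real.sin (inner ℝ u t)) (-u) =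
        -S.indicator (fun u : V ↦ Real.sin (inner ℝ u t)) u := by
      by_cases hu : u ∈ S <;> simp [hsymm, hu]
    simp_rw [hodd] at h
    rw [integral_neg] at h
    linarith
  have hci : Integrable (fun u ↦ Real.cos (inner ℝ u t)) l :=
    integrable_of_abs_le (by fun_prop) fun u ↦ Real.abs_cos_le_one _
  have hsi : Integrable (fun u ↦ Real.sin (inner ℝ u t)) l :=
    integrable_of_abs_le (by fun_prop) fun u ↦ Real.abs_sin_le_one _
  have hchar : charFun l t = ((∫ u, Real.cos (inner ℝ u t) ∂l : ℝ) : ℂ) := by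
    rw [charFun_apply]
    have : ∀ u : V, Complex.exp (inner ℝ u t * Complex.I) =
        (Real.cos (inner ℝ u t) : ℂ) + (Real.sin (inner ℝ u t) : ℂ) * Complex.I := fun u ↦ by
      rw [Complex.exp_mul_I, Complex.ofReal_cos, Complex.ofReal_sin]
    simp_rw [this]
    rw [integral_add hci.ofReal (hsi.ofReal.mul_const _), integral_mul_const,
      integral_complex_ofReal, integral_complex_ofReal, hsin]
    simp
  rw [charFun_compoundPoisson, hchar, integral_sub (integrable_const _) hci]
  push_cast
  simp

/-- The existence part of the Lévy continuity theorem. -/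
lemma exists_isProbabilityMeasure_charFun_eq {E : Type*} [NormedAddCommGroup E]
    [InnerProductSpace ℝ E] [FiniteDimensional ℝ E] [MeasurableSpace E] [BorelSpace E]
    {μ : ℕ → Measure E} [∀ n, IsProbabilityMeasure (μ n)] {φ : E → ℂ} (hφ : ContinuousAt φ 0)
    (h : ∀ t, Filter.Tendsto (fun n ↦ charFun (μ n) t) Filter.atTop (nhds (φ t))) :
    ∃ ρ : Measure E, IsProbabilityMeasure ρ ∧ ∀ t, charFun ρ t = φ t := by
  let μ' : ℕ → ProbabilityMeasure E := fun n ↦ ⟨μ n, inferInstance⟩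
  have htight := isTightMeasureSet_of_tendsto_charFun hφ h
  have hcomp : IsCompact (closure (Set.range μ')) := by
    refine isCompact_closure_of_isTightMeasureSet ?_
    convert! htight using 1
    ext m
    exact ⟨fun ⟨_, ⟨n, hn⟩, hm⟩ ↦ ⟨n, by rw [← hm, ← hn]; rfl⟩, fun ⟨n, hn⟩ ↦ ⟨μ' n, ⟨n, rfl⟩, hn⟩⟩
  -- Tightness gives compactness, and an ultrafilter limit replaces the extraction of a subsequence.
  let U : Ultrafilter ℕ := Filter.hyperfilter ℕ
  have hU : (U : Filter ℕ) ≤ Filter.atTop := Nat.hyperfilter_le_atTop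
  obtain ⟨ρ, -, hρ⟩ := hcomp.ultrafilter_le_nhds (U.map μ') (by
    rw [Filter.le_principal_iff]
    exact Filter.mem_map.2 (Filter.univ_mem' fun n ↦ subset_closure ⟨n, rfl⟩))
  refine ⟨ρ, inferInstance, fun t ↦ ?_⟩
  have hρ' : Filter.Tendsto μ' U (nhds ρ) := hρ
  rw [ProbabilityMeasure.tendsto_iff_forall_integral_rclike_tendsto ℂ] at hρ'
  have h1 := hρ' (BoundedContinuousFunction.innerProbChar t)
  simp_rw [← charFun_eq_integral_innerProbChar] at h1
  exact tendsto_nhds_unique h1 ((h t).mono_left hU)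

end StableLevyMeasure

/-! ### The Poincaré inequality for the stable law. -/

section StablePoincare

variable {d : ℕ} {α : ℝ}

local notation "V" => EuclideanSpace ℝ (Fin d)

lemma measurableSet_lt_norm (ε : ℝ) : MeasurableSet {u : V | ε < ‖u‖} :=
  measurableSet_lt (by fun_prop) (by fun_prop)

lemma measurableSet_shell (δ ε : ℝ) : MeasurableSet {u : V | δ < ‖u‖ ∧ ‖u‖ ≤ ε} :=
  (measurableSet_lt_norm δ).inter (measurableSet_le measurable_norm measurable_const)

lemma one_sub_cos_nonneg (u t : V) : 0 ≤ 1 - Real.cos (inner ℝ u t) :=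
  sub_nonneg.2 (Real.cos_le_one _)

/-- The law of the small jumps of the stable distribution. -/
lemma exists_smallJumps (hα₁ : 1 < α) (hα₂ : α < 2) (ε : ℝ) :
    ∃ ρ : Measure V, IsProbabilityMeasure ρ ∧ ∀ t, charFun ρ t =
      ((Real.exp (-∫ u in {u | 0 < ‖u‖ ∧ ‖u‖ ≤ ε}, (1 - Real.cos (inner ℝ u t))
        ∂(stableLevyMeasure d α)) : ℝ) : ℂ) := by
  let S : ℕ → Set V := fun k ↦ {u | 1 / ((k : ℝ) + 1) < ‖u‖ ∧ ‖u‖ ≤ ε}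
  have hSm (k : ℕ) : MeasurableSet (S k) := measurableSet_shell _ _
  have hmono : Monotone S := fun k n hkn u hu ↦ ⟨(one_div_le_one_div_of_le (by positivity)
    (by simpa using hkn)).trans_lt hu.1, hu.2⟩
  have hU : ⋃ k, S k = {u | 0 < ‖u‖ ∧ ‖u‖ ≤ ε} := by
    ext u
    simp only [Set.mem_iUnion]
    refine ⟨fun ⟨k, hk⟩ ↦ ⟨lt_trans (by positivity) hk.1, hk.2⟩, fun hu ↦ ?_⟩
    obtain ⟨k, hk⟩ := exists_nat_one_div_lt hu.1
    exact ⟨k, hk, hu.2⟩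
  have hfin (k : ℕ) : stableLevyMeasure d α (S k) < ∞ :=
    (measure_mono fun u hu ↦ hu.1).trans_lt
      (stableLevyMeasure_lt_top hα₁ hα₂ (by positivity : 0 < 1 / ((k : ℝ) + 1)))
  have hfinm (k : ℕ) : IsFiniteMeasure ((stableLevyMeasure d α).restrict (S k)) :=
    ⟨by simpa using hfin k⟩
  refine exists_isProbabilityMeasure_charFun_eq
    (μ := fun k ↦ compoundPoisson ((stableLevyMeasure d α).restrict (S k))) ?_ fun t ↦ ?_
  -- Continuity at the origin: the exponent of the small jumps is squeezed between 0 and the full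
  -- exponent `‖t‖ ^ α / 2`.
  · have hα0 : α ≠ 0 := by linarith
    have hcont : Continuous fun t : V ↦ ‖t‖ ^ α / 2 :=
      (continuous_norm.rpow_const fun _ ↦ Or.inr (by linarith)).div_const _
    have h0 := hcont.tendsto 0
    simp only [norm_zero, Real.zero_rpow hα0, zero_div] at h0
    have hr : ContinuousAt (fun t : V ↦ ∫ u in {u | 0 < ‖u‖ ∧ ‖u‖ ≤ ε},
        (1 - Real.cos (inner ℝ u t)) ∂(stableLevyMeasure d α)) 0 := by
      unfold ContinuousAt
      simp only [inner_zero_right, Real.cos_zero, sub_self, integral_zero]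
      refine squeeze_zero (fun t ↦ integral_nonneg fun u ↦ one_sub_cos_nonneg u t) (fun t ↦ ?_) h0
      rw [← integral_one_sub_cos hα₁ hα₂ t]
      exact setIntegral_le_integral (integrable_one_sub_cos hα₁ hα₂ t)
        (.of_forall fun u ↦ one_sub_cos_nonneg u t)
    exact Complex.continuous_ofReal.continuousAt.comp
      (Real.continuous_exp.continuousAt.comp hr.neg)
  · refine Filter.Tendsto.congr (fun k ↦ (charFun_compoundPoisson_restrict (hSm k)
      (fun u ↦ by simp [S]) (hfin k) t).symm) ?_
    refine (Complex.continuous_ofReal.tendsto _).comp ((Real.continuous_exp.tendsto _).comp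
      (Filter.Tendsto.neg ?_))
    rw [← hU]
    exact tendsto_setIntegral_of_monotone hSm hmono
      (integrable_one_sub_cos hα₁ hα₂ t).integrableOn

/-- A Lévy–Itô splitting read on characteristic functions: the two regions miss only the origin,
where `1 - cos` vanishes. -/
lemma compoundPoisson_conv_smallJumps (hα₁ : 1 < α) (hα₂ : α < 2) {ε : ℝ} (hε : 0 < ε)
    {μ ρ : Measure V} [IsProbabilityMeasure μ] [IsProbabilityMeasure ρ]
    (hμ : ∀ t, charFun μ t = ((Real.exp (-(‖t‖ ^ α / 2)) : ℝ) : ℂ))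
    (hρ : ∀ t, charFun ρ t = ((Real.exp (-∫ u in {u | 0 < ‖u‖ ∧ ‖u‖ ≤ ε},
      (1 - Real.cos (inner ℝ u t)) ∂(stableLevyMeasure d α)) : ℝ) : ℂ)) :
    compoundPoisson ((stableLevyMeasure d α).restrict {u | ε < ‖u‖}) ∗ ρ = μ := by
  have hfin := stableLevyMeasure_lt_top (d := d) hα₁ hα₂ hε
  have : IsFiniteMeasure ((stableLevyMeasure d α).restrict {u | ε < ‖u‖}) :=
    ⟨by simpa using hfin⟩
  refine Measure.ext_of_charFun (funext fun t ↦ ?_)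
  have hi := integrable_one_sub_cos (d := d) hα₁ hα₂ t
  rw [charFun_conv, charFun_compoundPoisson_restrict (measurableSet_lt_norm ε)
    (fun u ↦ by simp) hfin, hρ, hμ, ← Complex.ofReal_mul, ← Real.exp_add, ← neg_add,
    ← setIntegral_union _ (measurableSet_shell _ _) hi.integrableOn hi.integrableOn,
    setIntegral_eq_integral_of_forall_compl_eq_zero, integral_one_sub_cos hα₁ hα₂]
  · intro u hu
    have hu0 : u = 0 := by
      by_contra h
      refine hu ?_
      rcases lt_or_ge ε ‖u‖ with h1 | h1
      · exact Or.inl h1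
      · exact Or.inr ⟨norm_pos_iff.2 h, h1⟩
    simp [hu0]
  · exact Set.disjoint_left.2 fun u h1 h2 ↦ not_lt.2 h2.2 h1

lemma ofReal_integral_jumpEnergy_le {μ : Measure V} [IsProbabilityMeasure μ] {S : Set V}
    (hS : stableLevyMeasure d α S < ∞) {f : V → ℝ} (hf : Measurable f) {M : ℝ}
    (hM : ∀ x, |f x| ≤ M) :
    ENNReal.ofReal (∫ x, jumpEnergy ((stableLevyMeasure d α).restrict S) f x ∂μ) ≤
      nonlocalEnergy d α μ f := by
  have : IsFiniteMeasure ((stableLevyMeasure d α).restrict S) := ⟨by simpa using hS⟩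
  rw [ofReal_integral_eq_lintegral_ofReal (integrable_of_abs_le (measurable_jumpEnergy _ hf)
    (abs_jumpEnergy_le _ hM)) (.of_forall (jumpEnergy_nonneg _ f)), nonlocalEnergy]
  refine lintegral_mono fun x ↦ ?_
  rw [jumpEnergy, ofReal_integral_eq_lintegral_ofReal (integrable_of_abs_le (by fun_prop)
    fun u ↦ abs_sub_sq_le hM _ _) (.of_forall fun u ↦ sq_nonneg _)]
  simp_rw [sq_abs]
  exact lintegral_mono' Measure.restrict_le_self le_rfl

/-- The Poincaré inequality for the stable distribution, for bounded functions. -/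
lemma ofReal_variance_le_nonlocalEnergy_of_bounded (hα₁ : 1 < α) (hα₂ : α < 2) {μ : Measure V}
    [IsProbabilityMeasure μ] (hμ : ∀ t, charFun μ t = ((Real.exp (-(‖t‖ ^ α / 2)) : ℝ) : ℂ))
    {f : V → ℝ} (hf : Measurable f) {M : ℝ} (hM : ∀ x, |f x| ≤ M) :
    ENNReal.ofReal Var[f; μ] ≤ nonlocalEnergy d α μ f := by
  rcases eq_or_ne (nonlocalEnergy d α μ f) ∞ with hE | hE
  · simp [hE]
  have hε (n : ℕ) : 0 < 1 / ((n : ℝ) + 1) := by positivity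
  choose ρ hρp hρ using fun n : ℕ ↦ exists_smallJumps (d := d) hα₁ hα₂ (1 / ((n : ℝ) + 1))
  have hfin (n : ℕ) := stableLevyMeasure_lt_top (d := d) hα₁ hα₂ (hε n)
  have hfinm (n : ℕ) : IsFiniteMeasure
      ((stableLevyMeasure d α).restrict {u | 1 / ((n : ℝ) + 1) < ‖u‖}) := ⟨by simpa using hfin n⟩
  refine ENNReal.ofReal_le_of_le_toReal ?_
  refine variance_le_of_conv_compoundPoisson
    (fun n ↦ compoundPoisson_conv_smallJumps hα₁ hα₂ (hε n) hμ (hρ n)) (fun t ↦ ?_) hf hM fun n ↦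
      (ENNReal.ofReal_le_iff_le_toReal hE).1 (ofReal_integral_jumpEnergy_le (hfin n) hf hM)
  simp_rw [hρ]
  -- The punctured balls decrease to the empty set, so the exponent of `ρ n` tends to 0.
  have hlim := tendsto_setIntegral_of_antitone (μ := stableLevyMeasure d α)
    (f := fun u : V ↦ 1 - Real.cos (inner ℝ u t))
    (s := fun n : ℕ ↦ {u : V | 0 < ‖u‖ ∧ ‖u‖ ≤ 1 / ((n : ℝ) + 1)})
    (fun n ↦ measurableSet_shell _ _)
    (fun k n hkn u hu ↦ ⟨hu.1, hu.2.trans (one_div_le_one_div_of_le (by positivity)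
      (by simpa using hkn))⟩) ⟨0, (integrable_one_sub_cos hα₁ hα₂ t).integrableOn⟩
  have hempty : ⋂ n : ℕ, {u : V | 0 < ‖u‖ ∧ ‖u‖ ≤ 1 / ((n : ℝ) + 1)} = ∅ := by
    refine Set.eq_empty_of_forall_notMem fun u hu ↦ ?_
    rw [Set.mem_iInter] at hu
    obtain ⟨n, hn⟩ := exists_nat_one_div_lt (hu 0).1
    exact absurd (hu n).2 (not_le.2 hn)
  rw [hempty, setIntegral_empty] at hlim
  have := (Complex.continuous_ofReal.tendsto _).comp ((Real.continuous_exp.tendsto _).comp hlim.neg)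
  simpa [Function.comp_def] using this

/-- Clipping is 1-Lipschitz, so truncating `f` cannot increase its energy. -/
lemma abs_clip_sub_clip_le (N a b : ℝ) :
    |max (-N) (min N a) - max (-N) (min N b)| ≤ |a - b| :=
  (abs_max_sub_max_le_max _ _ _ _).trans (max_le (by simp)
    ((abs_min_sub_min_le_max _ _ _ _).trans (by simp)))

lemma tendsto_variance_clip {Ω : Type*} [MeasurableSpace Ω] {μ : Measure Ω}
    [IsProbabilityMeasure μ] {f : Ω → ℝ} (hf : Measurable f) (hf2 : MemLp f 2 μ) :
    Filter.Tendsto (fun n : ℕ ↦ Var[fun x ↦ max (-(n : ℝ)) (min n (f x)); μ]) Filter.atTop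
      (nhds Var[f; μ]) := by
  have hle (n : ℕ) (x : Ω) : |max (-(n : ℝ)) (min n (f x))| ≤ |f x| := by
    simpa using abs_clip_sub_clip_le n (f x) 0
  have hm (n : ℕ) : Measurable fun x ↦ max (-(n : ℝ)) (min n (f x)) := by fun_prop
  have hlim (x : Ω) : Filter.Tendsto (fun n : ℕ ↦ max (-(n : ℝ)) (min n (f x))) Filter.atTop
      (nhds (f x)) := by
    obtain ⟨N, hN⟩ := exists_nat_ge |f x|
    refine tendsto_const_nhds.congr' ?_
    filter_upwards [Filter.eventually_ge_atTop N] with n hn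
    have hn' : |f x| ≤ n := hN.trans (by exact_mod_cast hn)
    rw [min_eq_right (abs_le.1 hn').2, max_eq_right (abs_le.1 hn').1]
  have hmem (n : ℕ) : MemLp (fun x ↦ max (-(n : ℝ)) (min n (f x))) 2 μ :=
    hf2.mono (hm n).aestronglyMeasurable (.of_forall (hle n))
  simp_rw [fun n : ℕ ↦ variance_eq_sub (hmem n), variance_eq_sub hf2]
  refine Filter.Tendsto.sub ?_ (Filter.Tendsto.pow ?_ 2)
  · refine tendsto_integral_of_dominated_convergence (fun x ↦ f x ^ 2)
      (fun n ↦ ((hm n).pow_const 2).aestronglyMeasurable) hf2.integrable_sq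
      (fun n ↦ .of_forall fun x ↦ ?_) (.of_forall fun x ↦ (hlim x).pow 2)
    simpa using sq_le_sq.2 (hle n x)
  · exact tendsto_integral_of_dominated_convergence (fun x ↦ |f x|)
      (fun n ↦ (hm n).aestronglyMeasurable) (hf2.integrable (by norm_num)).abs
      (fun n ↦ .of_forall (hle n)) (.of_forall hlim)

/-- The Poincaré inequality for the stable distribution. -/
theorem evariance_le_nonlocalEnergy (hα₁ : 1 < α) (hα₂ : α < 2) {μ : Measure V}
    [IsProbabilityMeasure μ] (hμ : ∀ t, charFun μ t = ((Real.exp (-(‖t‖ ^ α / 2)) : ℝ) : ℂ))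
    {f : V → ℝ} (hf : Measurable f) (hf2 : MemLp f 2 μ) :
    evariance f μ ≤ nonlocalEnergy d α μ f := by
  rw [← ofReal_variance hf2]
  refine le_of_tendsto' ((ENNReal.continuous_ofReal.tendsto _).comp (tendsto_variance_clip hf hf2))
    fun n ↦ ?_
  refine (ofReal_variance_le_nonlocalEnergy_of_bounded hα₁ hα₂ hμ (M := n) (by fun_prop)
    fun x ↦ abs_le.2 ⟨le_max_left _ _, max_le (by linarith [(Nat.cast_nonneg n : (0 : ℝ) ≤ n)])
      (min_le_left _ _)⟩).trans ?_
  refine lintegral_mono fun x ↦ lintegral_mono fun u ↦ ENNReal.ofReal_le_ofReal ?_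
  exact pow_le_pow_left₀ (abs_nonneg _) (abs_clip_sub_clip_le _ _ _) 2

/-! ### Sharpness: testing the characters. -/

lemma measurable_lintegral_increment {f : V → ℝ} (hf : Measurable f) :
    Measurable fun x ↦ ∫⁻ u, ENNReal.ofReal (|f (x + u) - f x| ^ 2)
      ∂(stableLevyMeasure d α) := by
  have : SFinite (stableLevyMeasure d α) := by unfold stableLevyMeasure; infer_instance
  refine Measurable.lintegral_prod_right' (f := fun z : V × V ↦
    ENNReal.ofReal (|f (z.1 + z.2) - f z.1| ^ 2)) ?_
  have : Measurable fun z : V × V ↦ f (z.1 + z.2) - f z.1 := by fun_prop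
  exact (this.abs.pow_const 2).ennreal_ofReal

/-- The squared increment of the character, `|exp(i⟨u, ξ⟩) - 1|² = 2 (1 - cos ⟨u, ξ⟩)`, does not
depend on `x`. -/
lemma nonlocalEnergy_cos_add_sin (hα₁ : 1 < α) (hα₂ : α < 2) (μ : Measure V)
    [IsProbabilityMeasure μ] (ξ : V) :
    nonlocalEnergy d α μ (fun x ↦ Real.cos (inner ℝ x ξ)) +
      nonlocalEnergy d α μ (fun x ↦ Real.sin (inner ℝ x ξ)) = ENNReal.ofReal (‖ξ‖ ^ α) := by
  unfold nonlocalEnergy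
  refine (lintegral_add_left (measurable_lintegral_increment
    (f := fun x ↦ Real.cos (inner ℝ x ξ)) (by fun_prop)) _).symm.trans ?_
  have hx (x : V) : ∫⁻ u, ENNReal.ofReal (|Real.cos (inner ℝ (x + u) ξ) -
        Real.cos (inner ℝ x ξ)| ^ 2) ∂(stableLevyMeasure d α) +
      ∫⁻ u, ENNReal.ofReal (|Real.sin (inner ℝ (x + u) ξ) -
        Real.sin (inner ℝ x ξ)| ^ 2) ∂(stableLevyMeasure d α) = ENNReal.ofReal (‖ξ‖ ^ α) := by
    rw [← lintegral_add_left (by fun_prop), show ‖ξ‖ ^ α = 2 * (‖ξ‖ ^ α / 2) by ring,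
      ENNReal.ofReal_mul zero_le_two, ← lintegral_one_sub_cos_stableLevyMeasure hα₁ hα₂,
      ← lintegral_const_mul _ (by fun_prop)]
    refine lintegral_congr fun u ↦ ?_
    rw [← ENNReal.ofReal_add (by positivity) (by positivity), ← ENNReal.ofReal_mul zero_le_two,
      sq_abs, sq_abs, inner_add_left, Real.cos_add, Real.sin_add]
    congr 1
    have h1 := Real.sin_sq_add_cos_sq (inner ℝ x ξ)
    have h2 := Real.sin_sq_add_cos_sq (inner ℝ u ξ)
    linear_combination (2 - 2 * Real.cos (inner ℝ u ξ)) * h1 +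
      (Real.sin (inner ℝ x ξ) ^ 2 + Real.cos (inner ℝ x ξ) ^ 2) * h2
  simp_rw [hx]
  simp

/-- A character has modulus 1, and its mean is `charFun μ ξ`, here real. -/
lemma variance_cos_add_sin {μ : Measure V} [IsProbabilityMeasure μ] (ξ : V) {r : ℝ}
    (hμ : charFun μ ξ = (r : ℂ)) :
    Var[fun x ↦ Real.cos (inner ℝ x ξ); μ] + Var[fun x ↦ Real.sin (inner ℝ x ξ); μ] =
      1 - r ^ 2 := by
  have hcm : Measurable fun x : V ↦ Real.cos (inner ℝ x ξ) := by fun_prop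
  have hsm : Measurable fun x : V ↦ Real.sin (inner ℝ x ξ) := by fun_prop
  have hc1 (x : V) := Real.abs_cos_le_one (inner ℝ x ξ)
  have hs1 (x : V) := Real.abs_sin_le_one (inner ℝ x ξ)
  have hci : Integrable _ μ := integrable_of_abs_le hcm hc1
  have hsi : Integrable _ μ := integrable_of_abs_le hsm hs1
  have hexp (x : V) : Complex.exp (inner ℝ x ξ * Complex.I) =
      (Real.cos (inner ℝ x ξ) : ℂ) + (Real.sin (inner ℝ x ξ) : ℂ) * Complex.I := by
    rw [Complex.exp_mul_I, Complex.ofReal_cos, Complex.ofReal_sin]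
  rw [charFun_apply] at hμ
  simp_rw [hexp] at hμ
  rw [integral_add hci.ofReal (hsi.ofReal.mul_const _), integral_mul_const,
    integral_complex_ofReal, integral_complex_ofReal] at hμ
  have hre : ∫ x, Real.cos (inner ℝ x ξ) ∂μ = r := by simpa using congrArg Complex.re hμ
  have him : ∫ x, Real.sin (inner ℝ x ξ) ∂μ = 0 := by simpa using congrArg Complex.im hμ
  rw [variance_eq_sub (memLp_two_of_abs_le hcm hc1), variance_eq_sub (memLp_two_of_abs_le hsm hs1),
    hre, him]
  have hsum : ∫ x, Real.cos (inner ℝ x ξ) ^ 2 ∂μ + ∫ x, Real.sin (inner ℝ x ξ) ^ 2 ∂μ = 1 := by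
    rw [← integral_add (memLp_two_of_abs_le hcm hc1).integrable_sq
      (memLp_two_of_abs_le hsm hs1).integrable_sq]
    simp
  simp only [Pi.pow_apply]
  linarith

/-- Zero energy forces zero variance by the Poincaré inequality, so sine and cosine can be added
without checking that each is admissible. -/
lemma evariance_le_poincareU_mul (hα₁ : 1 < α) (hα₂ : α < 2) {μ : Measure V}
    [IsProbabilityMeasure μ] (hμ : ∀ t, charFun μ t = ((Real.exp (-(‖t‖ ^ α / 2)) : ℝ) : ℂ))
    {f : V → ℝ} (hf : Measurable f) (hf2 : MemLp f 2 μ) (hE : nonlocalEnergy d α μ f < ∞) :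
    evariance f μ ≤ poincareU d α μ * nonlocalEnergy d α μ f := by
  have hle := evariance_le_nonlocalEnergy hα₁ hα₂ hμ hf hf2
  rcases eq_or_ne (nonlocalEnergy d α μ f) 0 with h0 | h0
  · rw [h0] at hle ⊢
    simpa using hle
  · rw [← ENNReal.div_le_iff h0 hE.ne]
    exact le_iSup₂_of_le f ⟨hf, hf2, pos_iff_ne_zero.2 h0, hE⟩ le_rfl

lemma ofReal_le_poincareU (hd : 1 ≤ d) (hα₁ : 1 < α) (hα₂ : α < 2) {μ : Measure V}
    [IsProbabilityMeasure μ] (hμ : ∀ t, charFun μ t = ((Real.exp (-(‖t‖ ^ α / 2)) : ℝ) : ℂ))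
    {t : ℝ} (ht : 0 < t) : ENNReal.ofReal (1 / (1 + t)) ≤ poincareU d α μ := by
  have hα0 : α ≠ 0 := by linarith
  obtain ⟨ξ, hξ⟩ : ∃ ξ : V, ‖ξ‖ ^ α = t := by
    refine ⟨EuclideanSpace.single ⟨0, hd⟩ (t ^ α⁻¹), ?_⟩
    rw [PiLp.norm_single, Real.norm_of_nonneg (by positivity),
      Real.rpow_inv_rpow ht.le hα0]
  have hcm : Measurable fun x : V ↦ Real.cos (inner ℝ x ξ) := by fun_prop
  have hsm : Measurable fun x : V ↦ Real.sin (inner ℝ x ξ) := by fun_prop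
  have hc2 : MemLp _ 2 μ := memLp_two_of_abs_le hcm fun x ↦ Real.abs_cos_le_one _
  have hs2 : MemLp _ 2 μ := memLp_two_of_abs_le hsm fun x ↦ Real.abs_sin_le_one _
  have hE := nonlocalEnergy_cos_add_sin hα₁ hα₂ μ ξ
  have hfin := hE.trans_lt ENNReal.ofReal_lt_top
  have hcos := evariance_le_poincareU_mul hα₁ hα₂ hμ hcm hc2 (le_self_add.trans_lt hfin)
  have hsin := evariance_le_poincareU_mul hα₁ hα₂ hμ hsm hs2 (le_add_self.trans_lt hfin)
  have hsum := add_le_add hcos hsin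
  rw [← mul_add, hE, ← ofReal_variance hc2, ← ofReal_variance hs2,
    ← ENNReal.ofReal_add (variance_nonneg _ _) (variance_nonneg _ _),
    variance_cos_add_sin ξ (hμ ξ), hξ, ← ENNReal.div_le_iff (by simpa using ht) (by simp),
    ← ENNReal.ofReal_div_of_pos ht, ← Real.exp_nat_mul] at hsum
  -- It remains to bound `(1 - exp (-t)) / t` below by `1 / (1 + t)`, which follows from `exp t ≥ 1
  -- + t`.
  refine le_trans (ENNReal.ofReal_le_ofReal ?_) hsum
  rw [le_div_iff₀ ht, show ((2 : ℕ) : ℝ) * -(t / 2) = -t by push_cast; ring, Real.exp_neg]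
  have h1 : (Real.exp t)⁻¹ ≤ (1 + t)⁻¹ :=
    inv_anti₀ (by positivity) (by linarith [Real.add_one_le_exp t])
  have h2 : 1 / (1 + t) * t = 1 - (1 + t)⁻¹ := by field_simp; ring
  linarith

end StablePoincare

theorem mainTheorem9 (d : ℕ) (hd : 1 ≤ d) (α : ℝ) (hα₁ : 1 < α) (hα₂ : α < 2)
    (μ : Measure (EuclideanSpace ℝ (Fin d))) [IsProbabilityMeasure μ]
    (hμ : ∀ ξ : EuclideanSpace ℝ (Fin d),
      charFun μ ξ = ((Real.exp (-(‖ξ‖ ^ α / 2)) : ℝ) : ℂ)) :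
    poincareU d α μ = 1 := by
  refine le_antisymm (iSup₂_le fun f hf ↦ ?_) ?_
  · obtain ⟨hfm, hf2, h0, hE⟩ := hf
    rw [ENNReal.div_le_iff h0.ne' hE.ne, one_mul]
    exact evariance_le_nonlocalEnergy hα₁ hα₂ hμ hfm hf2
  · have hlim : Filter.Tendsto (fun n : ℕ ↦ ENNReal.ofReal (1 / (1 + 1 / ((n : ℝ) + 1))))
        Filter.atTop (nhds (ENNReal.ofReal (1 / (1 + 0)))) := by
      refine (ENNReal.continuous_ofReal.tendsto _).comp (Filter.Tendsto.div tendsto_const_nhds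
        (tendsto_one_div_add_atTop_nhds_zero_nat.const_add 1) (by norm_num))
    simp only [add_zero, div_one, ENNReal.ofReal_one] at hlim
    exact le_of_tendsto' hlim fun n ↦ ofReal_le_poincareU hd hα₁ hα₂ hμ (by positivity)
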